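/- Let $H$ be a complex Hilbert space, let $p \neq q$ in $\{1,\dots,n\}$, and let $X=(X_1,\dots,X_n)$ be a tuple of commuting contractions on $H$. A contraction $T$ is called pure if $\|T^{*m}h\|\to 0$ as $m \to \infty$ for every vector $h$. For a commuting tuple $Y=(Y_1,\dots,Y_k)$ put $$\mathbb S^{-1}(Y,Y^*) = \sum_{s\subseteq\{1,\dots,k\}} (-1)^{|s|}\, Y^{s} (Y^{s})^{*}, \qquad Y^s=\prod_{i\in s} Y_i ,$$ and let $\hat X_i$ be the $(n-1)$-tuple obtained from $X$ by deleting $X_i$. The class $\mathcal X^n_{p,q}(H)$ consists of the $n$-tuples $X$ of commuting contractions with $\mathbb S^{-1}(\hat X_p,\hat X_p^*)\ge 0$ and $\mathbb S^{-1}(\hat X_q,\hat X_q^*)\ge 0$ such that all entries of $\hat X_p$ are pure; such an $X$ has finite rank if $\overline{\operatorname{ran}}\;\mathbb S^{-1}(\hat X_i,\hat X_i^*)^{1/2}$ is finite dimensional for $i=p,q$. For a Hilbert space $\mathcal E$, let $H^2_{\mathcal E}(\mathbb D^{n-1})$ be the $\mathcal E$-valued Hardy space of the polydisc $\mathbb D^{n-1}$,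 whose $n-1$ coordinates are labelled $z_i$ with $i\in\{1,\dots,n\}\setminus\{q\}$: it consists of the functions $f(z)=\sum_{k} a_k z^k$ with $a_k \in \mathcal E$ and $\|f\|^2=\sum_k\|a_k\|^2<\infty$. Let $M_\Phi$ denote multiplication by $\Phi$, that is, $(M_\Phi f)(z)=\Phi(z)f(z)$. **Theorem.** Let $X=(X_1,\dots,X_n)\in\mathcal X^n_{p,q}(H)$ have finite rank, and suppose that every $X_i$ is a pure contraction. Then there are a Hilbert space $\mathcal E$, a unitary $U$ on $\mathcal E$, an orthogonal projection $P$ on $\mathcal E$ (with $P^\perp = I-P$) and an isometry $\Pi:H\to H^2_{\mathcal E}(\mathbb D^{n-1})$ with the following properties. Put $$\Phi_p(z)=(P+z_pP^{\perp})U^*,\qquad \Phi_q(z)=U(P^{\perp}+z_pP),$$ and $V_p=M_{\Phi_p}$, $V_q=M_{\Phi_q}$, $V_i=M_{z_i}$ for $i\ne p,q$. Then $V_1,\dots,V_n$ are well-defined bounded operators on $H^2_{\mathcal E}(\mathbb D^{n-1})$, they commute with each other, each of them is an isometry and a pure contraction, and $$\Pi X_i^*=V_i^*\,\Pi\qquad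 (i=1,\dots,n).$$ That is, $X$ dilates to the tuple of commuting pure isometries $(V_1,\dots,V_n)$. -/

import Mathlib

open scoped InnerProductSpace

universe u

noncomputable section

namespace PolydiscDilation

/-! ### The open unit polydisc and the vector-valued Hardy space -/

/-- The open unit polydisc, with coordinates labelled by `ι`. -/
abbrev Polydisc (ι : Type*) : Type _ := {z : ι → ℂ // ∀ i, ‖z i‖ < 1}

/-- The monomial `z ^ k = ∏ i, z i ^ k i`. -/
def monomial {ι : Type*} [Fintype ι] (k : ι → ℕ) (z : ι → ℂ) : ℂ := ∏ i, z i ^ k i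

/-- The `E`-valued Hardy space on the polydisc with coordinates labelled by `ι`: the space of the
functions `f z = ∑ k, z ^ k • a k` with square summable coefficients `a k ∈ E`, with the norm
`‖f‖ ^ 2 = ∑ k, ‖a k‖ ^ 2`. A function is stored through its coefficients; the instance of `RKHS`
below (whose content is that a function determines its coefficients, and that point evaluations are
bounded) makes its elements functions `Polydisc ι → E`. -/
def HardySpace (ι E : Type*) [NormedAddCommGroup E] : Type _ :=
  lp (fun _ : ι → ℕ => E) 2

namespace HardySpace

variable {ι E : Type*} [NormedAddCommGroup E]

instance : NormedAddCommGroup (HardySpace ι E) :=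
  inferInstanceAs (NormedAddCommGroup (lp (fun _ : ι → ℕ => E) 2))

instance [InnerProductSpace ℂ E] : InnerProductSpace ℂ (HardySpace ι E) :=
  inferInstanceAs (InnerProductSpace ℂ (lp (fun _ : ι → ℕ => E) 2))

instance [CompleteSpace E] : CompleteSpace (HardySpace ι E) :=
  inferInstanceAs (CompleteSpace (lp (fun _ : ι → ℕ => E) 2))

/-- The `k`-th Taylor coefficient of an element of the Hardy space. -/
def coeff (f : HardySpace ι E) (k : ι → ℕ) : E :=
  (show lp (fun _ : ι → ℕ => E) 2 from f) k

theorem hasSum_norm_sq (f : HardySpace ι E) :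
    HasSum (fun k => ‖f.coeff k‖ ^ 2) (‖f‖ ^ 2) := by
  have h := lp.hasSum_norm (p := 2) (by norm_num) (show lp (fun _ : ι → ℕ => E) 2 from f)
  simp only [ENNReal.toReal_ofNat, Real.rpow_ofNat] at h
  exact h

variable [Fintype ι]

theorem summable_monomial_sq {z : ι → ℂ} (hz : ∀ i, ‖z i‖ < 1) :
    Summable (fun k : ι → ℕ => ‖monomial k z‖ ^ 2) := by
  classical
  have hq : ∀ i, ‖z i‖ ^ 2 < 1 := fun i => by
    have := hz i
    have h0 := norm_nonneg (z i)
    nlinarith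
  have hterm : ∀ k : ι → ℕ, ‖monomial k z‖ ^ 2 = ∏ i, (‖z i‖ ^ 2) ^ k i := fun k => by
    simp only [monomial, norm_prod, norm_pow, ← Finset.prod_pow]
    exact Finset.prod_congr rfl fun i _ => by ring
  refine summable_of_sum_le (c := ∏ i, (1 - ‖z i‖ ^ 2)⁻¹) (fun k => by positivity) fun u => ?_
  let N : ℕ := (u.sup fun k => Finset.univ.sup k) + 1
  have hsub : u ⊆ Fintype.piFinset fun _ : ι => Finset.range N := fun k hk => by
    simp only [Fintype.mem_piFinset, Finset.mem_range]
    intro i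
    have h1 : k i ≤ Finset.univ.sup k := Finset.le_sup (Finset.mem_univ i)
    have h2 : Finset.univ.sup k ≤ u.sup fun k => Finset.univ.sup k :=
      Finset.le_sup (f := fun k : ι → ℕ => Finset.univ.sup k) hk
    omega
  calc ∑ k ∈ u, ‖monomial k z‖ ^ 2
      ≤ ∑ k ∈ Fintype.piFinset fun _ : ι => Finset.range N, ‖monomial k z‖ ^ 2 :=
        Finset.sum_le_sum_of_subset_of_nonneg hsub fun _ _ _ => by positivity
    _ = ∏ i, ∑ j ∈ Finset.range N, (‖z i‖ ^ 2) ^ j := by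
        rw [Finset.prod_univ_sum]
        exact Finset.sum_congr rfl fun k _ => hterm k
    _ ≤ ∏ i, (1 - ‖z i‖ ^ 2)⁻¹ := by
        refine Finset.prod_le_prod (fun i _ => by positivity) fun i _ => ?_
        have hs := hasSum_geometric_of_lt_one (by positivity : 0 ≤ ‖z i‖ ^ 2) (hq i)
        exact sum_le_hasSum _ (fun j _ => by positivity) hs

theorem norm_series (f : HardySpace ι E) {z : ι → ℂ} (hz : ∀ i, ‖z i‖ < 1) :
    Summable (fun k => ‖monomial k z‖ * ‖f.coeff k‖) ∧
      ∑' k, ‖monomial k z‖ * ‖f.coeff k‖ ≤ √(∑' k : ι → ℕ, ‖monomial k z‖ ^ 2) * ‖f‖ := by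
  have h := Real.summable_and_inner_le_Lp_mul_Lq_tsum_of_nonneg (p := 2) (q := 2)
    (f := fun k : ι → ℕ => ‖monomial k z‖) (g := fun k => ‖f.coeff k‖)
    Real.HolderConjugate.two_two (fun _ => norm_nonneg _) (fun _ => norm_nonneg _)
    (by simpa using summable_monomial_sq hz) (by simpa using f.hasSum_norm_sq.summable)
  refine ⟨h.1, h.2.trans (le_of_eq ?_)⟩
  simp only [Real.rpow_two, f.hasSum_norm_sq.tsum_eq, ← Real.sqrt_eq_rpow,
    Real.sqrt_sq (norm_nonneg f)]

variable [InnerProductSpace ℂ E]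

theorem summable_series [CompleteSpace E] (f : HardySpace ι E) {z : ι → ℂ}
    (hz : ∀ i, ‖z i‖ < 1) : Summable (fun k => monomial k z • f.coeff k) :=
  Summable.of_norm (by simpa only [norm_smul] using (f.norm_series hz).1)

/-- Evaluation `f ↦ f z = ∑ k, z ^ k • a k` at a point of the polydisc. -/
def evalCLM [CompleteSpace E] (z : Polydisc ι) : HardySpace ι E →L[ℂ] E :=
  LinearMap.mkContinuous
    { toFun := fun f => ∑' k : ι → ℕ, monomial k z.1 • f.coeff k
      map_add' := fun f g => by
        rw [← (f.summable_series z.2).tsum_add (g.summable_series z.2)]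
        exact tsum_congr fun k => smul_add _ _ _
      map_smul' := fun c f => by
        rw [RingHom.id_apply, ← (f.summable_series z.2).tsum_const_smul c]
        exact tsum_congr fun k => smul_comm _ c (f.coeff k) }
    (√(∑' k : ι → ℕ, ‖monomial k z.1‖ ^ 2))
    (fun f => by
      refine le_trans (norm_tsum_le_tsum_norm ?_) ?_
      · simpa only [norm_smul] using (f.norm_series z.2).1
      · simpa only [norm_smul] using (f.norm_series z.2).2)

theorem evalCLM_apply [CompleteSpace E] (z : Polydisc ι) (f : HardySpace ι E) :
    evalCLM z f = ∑' k : ι → ℕ, monomial k z.1 • f.coeff k := rfl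

open MeasureTheory in
/-- A power series that vanishes on the polydisc has zero coefficients. -/
theorem coeff_eq_zero [CompleteSpace E] (f : HardySpace ι E)
    (hf : ∀ z : Polydisc ι, evalCLM z f = 0) (m : ι → ℕ) : f.coeff m = 0 := by
  classical
  let ν : Measure (AddCircle (1 : ℝ)) := AddCircle.haarAddCircle
  let μ : Measure (ι → AddCircle (1 : ℝ)) := Measure.pi fun _ => ν
  let χ : (ι → ℤ) → (ι → AddCircle (1 : ℝ)) → ℂ := fun n x => ∏ i, fourier (n i) (x i)
  have hχc : ∀ n, Continuous (χ n) := fun n => by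
    refine continuous_finsetProd _ fun i _ => ?_
    exact (fourier (n i)).continuous.comp (continuous_apply i)
  have hχn : ∀ n x, ‖χ n x‖ = 1 := fun n x => by
    simp only [χ, norm_prod, fourier_apply, Circle.norm_coe, Finset.prod_const_one]
  have hν : ∀ n : ℤ, ∫ x, (fourier n x : ℂ) ∂ν = if n = 0 then 1 else 0 := fun n => by
    have h := orthonormal_iff_ite.mp (orthonormal_fourier (T := 1)) 0 n
    rw [fourierLp, fourierLp, ContinuousMap.inner_toLp] at h
    simpa [eq_comm] using h
  have hμ : ∀ n : ι → ℤ, ∫ x, χ n x ∂μ = if n = 0 then 1 else 0 := fun n => by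
    have h := integral_fintype_prod_eq_prod (μ := fun _ : ι => ν)
      (f := fun i (x : AddCircle (1 : ℝ)) => (fourier (n i) x : ℂ))
    refine h.trans ?_
    simp only [hν]
    by_cases hn : n = 0
    · simp [hn]
    · obtain ⟨i, hi⟩ := Function.ne_iff.mp hn
      rw [if_neg hn]
      exact Finset.prod_eq_zero (Finset.mem_univ i) (if_neg hi)
  let r : ι → ℂ := fun _ => 1 / 2
  have hr : ∀ i, ‖r i‖ < 1 := fun i => by norm_num [r]
  let F : (ι → ℕ) → (ι → AddCircle (1 : ℝ)) → E := fun k x =>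
    (monomial k r * χ (fun i => (k i : ℤ) - m i) x) • f.coeff k
  have hFc : ∀ k, Continuous (F k) := fun k => by
    exact (continuous_const.mul (hχc _)).smul continuous_const
  have hFi : ∀ k, Integrable (F k) μ := fun k => by
    refine (integrable_const (‖monomial k r‖ * ‖f.coeff k‖)).mono'
      (hFc k).aestronglyMeasurable (Filter.Eventually.of_forall fun x => ?_)
    simp [F, norm_smul, hχn]
  have hFs : Summable fun k => ∫ x, ‖F k x‖ ∂μ := by
    refine (f.norm_series hr).1.congr fun k => ?_
    simp [F, norm_smul, hχn]
  have hsum := hasSum_integral_of_summable_integral_norm hFi hFs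
  have hzero : ∀ x, ∑' k, F k x = 0 := fun x => by
    let z : Polydisc ι := ⟨fun i => r i * fourier 1 (x i), fun i => by
      rw [norm_mul, fourier_apply, Circle.norm_coe, mul_one]
      exact hr i⟩
    have hz := hf z
    rw [evalCLM_apply] at hz
    have : ∀ k, F k x = χ (fun i => -(m i : ℤ)) x • (monomial k z.1 • f.coeff k) := fun k => by
      simp only [F, smul_smul]
      congr 1
      simp only [monomial, χ, z, mul_pow, Finset.prod_mul_distrib]
      rw [mul_left_comm, ← Finset.prod_mul_distrib (f := fun i => fourier (-(m i : ℤ)) (x i))]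
      congr 1
      refine Finset.prod_congr rfl fun i _ => ?_
      rw [sub_eq_add_neg, fourier_add, mul_comm]
      congr 1
      simp only [fourier_apply, one_smul, natCast_zsmul, AddCircle.toCircle_nsmul]
      simp
    simp only [this]
    rw [(f.summable_series z.2).tsum_const_smul, hz, smul_zero]
  have hint : ∀ k, ∫ x, F k x ∂μ = if k = m then monomial m r • f.coeff m else 0 := fun k => by
    simp only [F]
    rw [integral_smul_const, integral_const_mul, hμ]
    by_cases hk : k = m
    · subst hk
      have h0 : (fun i => (k i : ℤ) - k i) = 0 := by ext i; simp
      rw [if_pos h0, if_pos rfl, mul_one]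
    · have h0 : (fun i => (k i : ℤ) - m i) ≠ 0 := fun h => hk <| by
        ext i
        have := congrFun h i
        simp only [Pi.zero_apply] at this
        omega
      simp [h0, hk]
  simp only [hint, hzero, integral_zero] at hsum
  have h := hsum.unique (hasSum_ite_eq m (monomial m r • f.coeff m))
  have hne : monomial m r ≠ 0 := by
    simp [monomial, r, Finset.prod_ne_zero_iff]
  exact (smul_eq_zero.mp h.symm).resolve_left hne

instance [CompleteSpace E] : RKHS ℂ (HardySpace ι E) (Polydisc ι) E where
  coeCLM := ContinuousLinearMap.pi fun z => evalCLM z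
  coeCLM_injective := by
    refine (injective_iff_map_eq_zero _).mpr fun f hf => ?_
    have h := f.coeff_eq_zero fun z => congrFun hf z
    exact lp.ext (funext h)

/-- The value of an element of the Hardy space is the sum of its power series. -/
theorem apply_eq_tsum [CompleteSpace E] (f : HardySpace ι E) (z : Polydisc ι) :
    f z = ∑' k : ι → ℕ, monomial k z.1 • f.coeff k := rfl

end HardySpace

/-- `T` is the multiplication operator `M_Φ` on the Hardy space, that is `(T f)(z) = Φ(z) f(z)`.
Since the elements of the Hardy space are functions, `Φ` determines `T`. -/
def IsMultiplicationOperator {ι E : Type*} [Fintype ι] [NormedAddCommGroup E]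
    [InnerProductSpace ℂ E] [CompleteSpace E] (Φ : Polydisc ι → E →L[ℂ] E)
    (T : HardySpace ι E →L[ℂ] HardySpace ι E) : Prop :=
  ∀ (f : HardySpace ι E) (z : Polydisc ι), (T f) z = Φ z (f z)

/-! ### Classes of operator tuples -/

section Operators

variable {H : Type*} [NormedAddCommGroup H] [InnerProductSpace ℂ H] [CompleteSpace H]

/-- A pure contraction: `‖T‖ ≤ 1` and `T*ᵐ → 0` in the strong operator topology. -/
def IsPureContraction (T : H →L[ℂ] H) : Prop :=
  ‖T‖ ≤ 1 ∧ ∀ h : H, Filter.Tendsto (fun m : ℕ => ‖(star T ^ m) h‖) Filter.atTop (nhds 0)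

/-- A pure isometry: an isometry that is a pure contraction. -/
def IsPureIsometry (T : H →L[ℂ] H) : Prop :=
  Isometry T ∧ IsPureContraction T

variable {ι : Type*}

/-- Tuples of commuting contractions. -/
def IsCommutingContractive (X : ι → H →L[ℂ] H) : Prop :=
  (∀ i, ‖X i‖ ≤ 1) ∧ ∀ i j, Commute (X i) (X j)

/-- The product of the operators `X i`, `i ∈ s`, in increasing order of the indices. -/
def subsetProd [LinearOrder ι] (X : ι → H →L[ℂ] H) (s : Finset ι) : H →L[ℂ] H :=
  (s.sort.map X).prod

/-- The hereditary calculus value `S⁻¹(X, X*) = ∑_s (-1)^|s| X^s (X^s)*`, the sum over all subsets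
`s` of the index set, for the inverse `∏ i, (1 - z i * conj (w i))` of the Szegő kernel. -/
def szegoInv [Fintype ι] [LinearOrder ι] (X : ι → H →L[ℂ] H) : H →L[ℂ] H :=
  ∑ s : Finset ι, (-1 : ℂ) ^ s.card • (subsetProd X s * star (subsetProd X s))

/-- The Szegő class: tuples of commuting contractions with `S⁻¹(X, X*) ≥ 0`. -/
def IsSzegoTuple [Fintype ι] [LinearOrder ι] (X : ι → H →L[ℂ] H) : Prop :=
  IsCommutingContractive X ∧ (szegoInv X).IsPositive

/-- The defect space of a tuple: the closure of the range of `S⁻¹(X, X*)^{1/2}`. -/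
def defectSpace [Fintype ι] [LinearOrder ι] (X : ι → H →L[ℂ] H) : Submodule ℂ H :=
  (CFC.sqrt (szegoInv X)).range.topologicalClosure

/-- The tuple `X` with its `p`-th entry removed. -/
def removeEntry {n : ℕ} (p : Fin n) (X : Fin n → H →L[ℂ] H) : {i : Fin n // i ≠ p} → H →L[ℂ] H :=
  fun i => X i

/-- The class of the `n`-tuples `X` of commuting contractions such that, with the `p`-th or with the
`q`-th entry removed, `X` lies in the Szegő class, and is pure with the `p`-th entry removed. -/
def IsClassPQ {n : ℕ} (p q : Fin n) (X : Fin n → H →L[ℂ] H) : Prop :=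
  IsCommutingContractive X ∧ IsSzegoTuple (removeEntry p X) ∧ IsSzegoTuple (removeEntry q X) ∧
    ∀ i, IsPureContraction (removeEntry p X i)

/-- Finite rank: both defect spaces are finite dimensional. -/
def IsFiniteRank {n : ℕ} (p q : Fin n) (X : Fin n → H →L[ℂ] H) : Prop :=
  FiniteDimensional ℂ (defectSpace (removeEntry p X)) ∧ FiniteDimensional ℂ (defectSpace (removeEntry q X))

end Operators

/-! ### Berger–Coburn–Lebow symbols -/

section Symbols

variable {n : ℕ} {E : Type*} [NormedAddCommGroup E] [InnerProductSpace ℂ E] [CompleteSpace E]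

/-- The symbols of the dilating tuple on the Hardy space over the polydisc with coordinates `z i`,
`i ≠ q`: `Φ_p(z) = (P + z_p P^⊥) U*`, `Φ_q(z) = U (P^⊥ + z_p P)`, and `z_i` for all other `i`. -/
def dilationSymbol {p q : Fin n} (hpq : p ≠ q) (U P : E →L[ℂ] E) (i : Fin n)
    (z : Polydisc {i : Fin n // i ≠ q}) : E →L[ℂ] E :=
  if hq : i = q then U * ((1 - P) + z.1 ⟨p, hpq⟩ • P)
  else if i = p then (P + z.1 ⟨p, hpq⟩ • (1 - P)) * star U
  else z.1 ⟨i, hq⟩ • 1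

end Symbols

end PolydiscDilation

end

noncomputable section

namespace PolydiscDilation

namespace HardySpace

variable {ι E : Type*} [NormedAddCommGroup E]

@[ext]
theorem coeff_ext {f g : HardySpace ι E} (h : ∀ k, f.coeff k = g.coeff k) : f = g :=
  lp.ext (funext h)

/-- The element of the Hardy space with given square summable coefficients. -/
def ofCoeff (a : (ι → ℕ) → E) (ha : Summable fun k => ‖a k‖ ^ 2) : HardySpace ι E :=
  show lp (fun _ : ι → ℕ => E) 2 from
    ⟨a, memℓp_gen (by simpa using ha)⟩

@[simp]
theorem coeff_ofCoeff (a : (ι → ℕ) → E) (ha : Summable fun k => ‖a k‖ ^ 2) (k : ι → ℕ) :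
    (ofCoeff a ha).coeff k = a k := rfl

@[simp]
theorem coeff_add (f g : HardySpace ι E) (k : ι → ℕ) :
    (f + g).coeff k = f.coeff k + g.coeff k := rfl

variable [InnerProductSpace ℂ E]

@[simp]
theorem coeff_smul (c : ℂ) (f : HardySpace ι E) (k : ι → ℕ) :
    (c • f).coeff k = c • f.coeff k := rfl

theorem hasSum_inner (f g : HardySpace ι E) :
    HasSum (fun k => ⟪f.coeff k, g.coeff k⟫_ℂ) ⟪f, g⟫_ℂ :=
  lp.hasSum_inner (𝕜 := ℂ) (show lp (fun _ : ι → ℕ => E) 2 from f) g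

theorem hasSum_coeff_comp (A : E →L[ℂ] E) {σ : (ι → ℕ) → ι → ℕ} (hσ : Function.Injective σ)
    (f : HardySpace ι E) :
    Summable (fun k => ‖A (f.coeff (σ k))‖ ^ 2) ∧
      ∑' k, ‖A (f.coeff (σ k))‖ ^ 2 ≤ (‖A‖ * ‖f‖) ^ 2 := by
  have h1 : HasSum (fun k => (‖A‖ * ‖f.coeff k‖) ^ 2) ((‖A‖ * ‖f‖) ^ 2) := by
    simpa only [mul_pow] using f.hasSum_norm_sq.mul_left (‖A‖ ^ 2)
  have h2 : Summable fun k => (‖A‖ * ‖f.coeff (σ k)‖) ^ 2 := h1.summable.comp_injective hσ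
  have hle : ∀ k, ‖A (f.coeff (σ k))‖ ^ 2 ≤ (‖A‖ * ‖f.coeff (σ k)‖) ^ 2 := fun k =>
    pow_le_pow_left₀ (norm_nonneg _) (A.le_opNorm _) 2
  have h3 := Summable.of_nonneg_of_le (fun k => by positivity) hle h2
  refine ⟨h3, ?_⟩
  refine hasSum_le_inj σ hσ (fun c _ => by positivity) hle h3.hasSum h1

/-- The operator that sends `∑ k, z ^ k • a k` to `∑ k, z ^ k • A (a (σ k))`. -/
def coeffComp (A : E →L[ℂ] E) (σ : (ι → ℕ) → ι → ℕ) (hσ : Function.Injective σ) :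
    HardySpace ι E →L[ℂ] HardySpace ι E :=
  LinearMap.mkContinuous
    { toFun := fun f => ofCoeff (fun k => A (f.coeff (σ k))) (hasSum_coeff_comp A hσ f).1
      map_add' := fun f g => by ext k; simp
      map_smul' := fun c f => by ext k; simp }
    ‖A‖
    (fun f => by
      refine le_of_sq_le_sq ?_ (by positivity)
      rw [← (hasSum_norm_sq _).tsum_eq]
      exact (hasSum_coeff_comp A hσ f).2)

@[simp]
theorem coeff_coeffComp (A : E →L[ℂ] E) (σ : (ι → ℕ) → ι → ℕ) (hσ : Function.Injective σ)
    (f : HardySpace ι E) (k : ι → ℕ) : (coeffComp A σ hσ f).coeff k = A (f.coeff (σ k)) := rfl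

/-- The backward shift in the coordinate `j`. -/
def backwardShift [DecidableEq ι] (j : ι) : HardySpace ι E →L[ℂ] HardySpace ι E :=
  coeffComp 1 (fun k => k + Pi.single j 1) (add_left_injective _)

@[simp]
theorem coeff_backwardShift [DecidableEq ι] (j : ι) (f : HardySpace ι E) (k : ι → ℕ) :
    (backwardShift j f).coeff k = f.coeff (k + Pi.single j 1) := rfl

variable [CompleteSpace E]

/-- Apply an operator of `E` to all coefficients. -/
def lift : (E →L[ℂ] E) →⋆ₐ[ℂ] (HardySpace ι E →L[ℂ] HardySpace ι E) where
  toFun A := coeffComp A id Function.injective_id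
  map_one' := by ext f k; simp
  map_mul' A B := by ext f k; simp
  map_zero' := by ext f k; simp; rfl
  map_add' A B := by ext f k; simp
  commutes' c := by ext f k; simp [Algebra.algebraMap_eq_smul_one]
  map_star' A := by
    rw [ContinuousLinearMap.star_eq_adjoint, ContinuousLinearMap.star_eq_adjoint,
      ContinuousLinearMap.eq_adjoint_iff]
    intro f g
    refine (hasSum_inner _ _).unique ?_
    simpa [ContinuousLinearMap.adjoint_inner_left] using
      hasSum_inner f (coeffComp A id Function.injective_id g)

@[simp]
theorem coeff_lift (A : E →L[ℂ] E) (f : HardySpace ι E) (k : ι → ℕ) :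
    (lift A f).coeff k = A (f.coeff k) := rfl

/-- The shift in the coordinate `j`. -/
def shift [DecidableEq ι] (j : ι) : HardySpace ι E →L[ℂ] HardySpace ι E :=
  star (backwardShift j)

theorem star_shift [DecidableEq ι] (j : ι) :
    star (shift j : HardySpace ι E →L[ℂ] HardySpace ι E) = backwardShift j := star_star _

open Classical in
theorem inner_coeff_shift [DecidableEq ι] (j : ι) (f : HardySpace ι E) (m : ι → ℕ) (v : E) :
    ⟪v, (shift j f).coeff m⟫_ℂ =
      ∑' k, if k + Pi.single j 1 = m then ⟪v, f.coeff k⟫_ℂ else 0 := by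
  classical
  let g : HardySpace ι E := ofCoeff (Pi.single m v) (by
    refine summable_of_ne_finset_zero (s := {m}) fun k hk => ?_
    rw [Pi.single_eq_of_ne (by simpa using hk)]; simp)
  have hg : ∀ k, g.coeff k = if k = m then v else 0 := fun k => by
    simp [g, Pi.single_apply]
  have h1 : ⟪g, shift j f⟫_ℂ = ⟪v, (shift j f).coeff m⟫_ℂ := by
    refine (hasSum_inner g (shift j f)).unique ?_
    convert hasSum_ite_eq m ⟪v, (shift j f).coeff m⟫_ℂ using 2 with k
    rw [hg]; split_ifs with h
    · rw [h]
    · simp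
  rw [← h1, shift, ContinuousLinearMap.star_eq_adjoint, ContinuousLinearMap.adjoint_inner_right,
    ← (hasSum_inner _ _).tsum_eq]
  refine tsum_congr fun k => ?_
  rw [coeff_backwardShift, hg]
  split_ifs <;> simp

theorem coeff_shift_add [DecidableEq ι] (j : ι) (f : HardySpace ι E) (k : ι → ℕ) :
    (shift j f).coeff (k + Pi.single j 1) = f.coeff k := by
  refine ext_inner_left ℂ fun v => ?_
  rw [inner_coeff_shift, tsum_eq_single k]
  · simp
  · intro l hl
    rw [if_neg fun h => hl (add_right_cancel h)]

theorem coeff_shift_eq_zero [DecidableEq ι] (j : ι) (f : HardySpace ι E) (m : ι → ℕ)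
    (hm : m ∉ Set.range fun k : ι → ℕ => k + Pi.single j 1) : (shift j f).coeff m = 0 := by
  refine ext_inner_left ℂ fun v => ?_
  rw [inner_coeff_shift, inner_zero_right]
  exact (tsum_congr fun k => if_neg fun h => hm ⟨k, h⟩).trans tsum_zero

theorem star_shift_mul_shift [DecidableEq ι] (j : ι) :
    star (shift j : HardySpace ι E →L[ℂ] HardySpace ι E) * shift j = 1 := by
  rw [star_shift]
  ext f k
  simp [coeff_shift_add]

theorem commute_shift_lift [DecidableEq ι] (j : ι) (A : E →L[ℂ] E) :
    Commute (shift j : HardySpace ι E →L[ℂ] HardySpace ι E) (lift A) := by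
  have h : ∀ A : E →L[ℂ] E,
      Commute (backwardShift j : HardySpace ι E →L[ℂ] HardySpace ι E) (lift A) := fun A => by
    ext f k; simp
  have h' := (h (star A)).star_star
  rwa [map_star, star_star] at h'

theorem commute_shift_shift [DecidableEq ι] (i j : ι) :
    Commute (shift i : HardySpace ι E →L[ℂ] HardySpace ι E) (shift j) := by
  have h : Commute (backwardShift i : HardySpace ι E →L[ℂ] HardySpace ι E) (backwardShift j) := by
    ext f k; simp [add_right_comm]
  exact h.star_star

variable [Fintype ι]

theorem lift_apply (A : E →L[ℂ] E) (f : HardySpace ι E) (z : Polydisc ι) :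
    (lift A f) z = A (f z) := by
  rw [apply_eq_tsum, apply_eq_tsum, A.map_tsum (f.summable_series z.2)]
  simp

theorem shift_apply [DecidableEq ι] (j : ι) (f : HardySpace ι E) (z : Polydisc ι) :
    (shift j f) z = z.1 j • f z := by
  rw [apply_eq_tsum, apply_eq_tsum, ← (f.summable_series z.2).tsum_const_smul,
    ← (add_left_injective (Pi.single j 1 : ι → ℕ)).tsum_eq]
  · refine tsum_congr fun k => ?_
    rw [coeff_shift_add, smul_smul]
    congr 1
    simp only [monomial, Pi.add_apply, pow_add, Finset.prod_mul_distrib]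
    rw [mul_comm]
    congr 1
    rw [Finset.prod_eq_single j] <;> simp +contextual
  · intro m hm
    by_contra h
    exact hm (by simp only [coeff_shift_eq_zero j f m h, smul_zero])

end HardySpace

/-! ### Multiplication operators and purity -/

section Multiplication

variable {ι E : Type*} [Fintype ι] [NormedAddCommGroup E] [InnerProductSpace ℂ E] [CompleteSpace E]

namespace IsMultiplicationOperator

theorem mul {Φ Ψ : Polydisc ι → E →L[ℂ] E} {S T : HardySpace ι E →L[ℂ] HardySpace ι E}
    (hS : IsMultiplicationOperator Φ S) (hT : IsMultiplicationOperator Ψ T) :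
    IsMultiplicationOperator (fun z => Φ z * Ψ z) (S * T) := fun f z => by
  simp [hS (T f) z, hT f z]

theorem add {Φ Ψ : Polydisc ι → E →L[ℂ] E} {S T : HardySpace ι E →L[ℂ] HardySpace ι E}
    (hS : IsMultiplicationOperator Φ S) (hT : IsMultiplicationOperator Ψ T) :
    IsMultiplicationOperator (fun z => Φ z + Ψ z) (S + T) := fun f z => by
  simp [hS f z, hT f z]

theorem lift (A : E →L[ℂ] E) :
    IsMultiplicationOperator (fun _ : Polydisc ι => A) (HardySpace.lift A) :=
  HardySpace.lift_apply A

theorem shift [DecidableEq ι] (j : ι) :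
    IsMultiplicationOperator (fun z : Polydisc ι => z.1 j • (1 : E →L[ℂ] E))
      (HardySpace.shift j) := fun f z => by
  simp [HardySpace.shift_apply]

theorem star_apply_kerFun {Φ : Polydisc ι → E →L[ℂ] E}
    {T : HardySpace ι E →L[ℂ] HardySpace ι E} (hT : IsMultiplicationOperator Φ T)
    (z : Polydisc ι) (v : E) :
    star T (RKHS.kerFun (HardySpace ι E) z v) =
      RKHS.kerFun (HardySpace ι E) z (star (Φ z) v) := by
  refine ext_inner_right ℂ fun f => ?_
  rw [ContinuousLinearMap.star_eq_adjoint, ContinuousLinearMap.adjoint_inner_left,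
    RKHS.kerFun_inner, RKHS.kerFun_inner, hT f z, ContinuousLinearMap.star_eq_adjoint,
    ContinuousLinearMap.adjoint_inner_left]

theorem star_pow_apply_kerFun {Φ : Polydisc ι → E →L[ℂ] E}
    {T : HardySpace ι E →L[ℂ] HardySpace ι E} (hT : IsMultiplicationOperator Φ T)
    (z : Polydisc ι) (v : E) (m : ℕ) :
    (star T ^ m) (RKHS.kerFun (HardySpace ι E) z v) =
      RKHS.kerFun (HardySpace ι E) z ((star (Φ z) ^ m) v) := by
  induction m with
  | zero => simp
  | succ m ih => rw [pow_succ', pow_succ', mul_apply_eq_comp, ih,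
      hT.star_apply_kerFun, mul_apply_eq_comp]

end IsMultiplicationOperator

end Multiplication

/-! ### Operators on finite dimensional spaces -/

section FiniteDimensional

variable {E : Type*} [NormedAddCommGroup E] [InnerProductSpace ℂ E]

open Filter in
/-- The powers of an operator all of whose eigenvalues lie in the open unit disc tend to zero. -/
theorem tendsto_pow_of_eigenvalue_norm_lt_one [FiniteDimensional ℂ E] (T : E →L[ℂ] E)
    (hT : ∀ (c : ℂ) (v : E), v ≠ 0 → T v = c • v → ‖c‖ < 1) :
    Tendsto (fun m : ℕ => T ^ m) atTop (nhds 0) := by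
  have := FiniteDimensional.complete ℂ E
  cases subsingleton_or_nontrivial E with
  | inl h =>
    have h0 : ∀ S : E →L[ℂ] E, S = 0 := fun S => by ext v; exact Subsingleton.elim _ _
    simp [h0 (T ^ _)]
  | inr h =>
    have hlt : spectralRadius ℂ T < ((1 : NNReal) : ENNReal) := by
      refine spectrum.spectralRadius_lt_of_forall_lt T fun c hc => ?_
      have hs := AlgEquiv.spectrum_eq (Module.End.toContinuousLinearMap E).symm T
      rw [← hs, ← Module.End.hasEigenvalue_iff_mem_spectrum] at hc
      obtain ⟨v, hv⟩ := hc.exists_hasEigenvector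
      exact hT c v hv.2 hv.apply_eq_smul
    obtain ⟨r, hr1, hr2⟩ := ENNReal.lt_iff_exists_nnreal_btwn.mp hlt
    have hr3 : r < 1 := by exact_mod_cast hr2
    have hev := (spectrum.pow_nnnorm_pow_one_div_tendsto_nhds_spectralRadius T).eventually_lt_const
      hr1
    refine squeeze_zero_norm' ?_ (tendsto_pow_atTop_nhds_zero_of_lt_one r.2 hr3)
    filter_upwards [hev, eventually_gt_atTop 0] with m hm hm0
    have h1 : ((‖T ^ m‖₊ : ENNReal) ^ (1 / (m : ℝ))) ^ (m : ℝ) ≤ (r : ENNReal) ^ (m : ℝ) :=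
      ENNReal.rpow_le_rpow hm.le (by positivity)
    rw [← ENNReal.rpow_mul, one_div_mul_cancel (by positivity), ENNReal.rpow_one,
      ENNReal.rpow_natCast] at h1
    exact_mod_cast h1

/-- Two linear maps into a finite dimensional space with equal norms differ by a unitary. -/
theorem exists_unitary_of_norm_eq [FiniteDimensional ℂ E] [CompleteSpace E] {H : Type*}
    [AddCommGroup H] [Module ℂ H] (A B : H →ₗ[ℂ] E) (h : ∀ x, ‖A x‖ = ‖B x‖) :
    ∃ U ∈ unitary (E →L[ℂ] E), ∀ x, U (A x) = B x := by
  obtain ⟨g, hg⟩ := A.rangeRestrict.exists_rightInverse_of_surjective A.range_rangeRestrict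
  have hAg : ∀ y, A (g y) = y := fun y => congrArg Subtype.val (LinearMap.congr_fun hg y)
  let L : A.range →ₗᵢ[ℂ] E := ⟨B ∘ₗ g, fun y => by
    rw [LinearMap.comp_apply, ← h, hAg]; rfl⟩
  have hL : ∀ x, L ⟨A x, x, rfl⟩ = B x := fun x => by
    change B (g _) = B x
    rw [← sub_eq_zero, ← map_sub, ← norm_eq_zero, ← h, map_sub, hAg, sub_self, norm_zero]
  let U := L.extend.toLinearIsometryEquiv rfl
  refine ⟨(Unitary.linearIsometryEquiv.symm U : E →L[ℂ] E), SetLike.coe_mem _, fun x => ?_⟩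
  rw [← hL x, ← LinearIsometry.extend_apply]
  rfl

end FiniteDimensional

section Projection

variable {E : Type*} [NormedAddCommGroup E] [InnerProductSpace ℂ E] [CompleteSpace E]

theorem inner_apply_left_of_isStarProjection {P : E →L[ℂ] E} (hP : IsStarProjection P) (x y : E) :
    ⟪P x, y⟫_ℂ = ⟪x, P y⟫_ℂ := by
  conv_rhs => rw [← hP.isSelfAdjoint.star_eq, ContinuousLinearMap.star_eq_adjoint,
    ContinuousLinearMap.adjoint_inner_right]

theorem norm_sq_isStarProjection_add_smul {P : E →L[ℂ] E} (hP : IsStarProjection P) (c : ℂ)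
    (v : E) : ‖P v + c • (v - P v)‖ ^ 2 = ‖P v‖ ^ 2 + ‖c‖ ^ 2 * ‖v - P v‖ ^ 2 := by
  have hPP : P (P v) = P v := congrArg (fun T : E →L[ℂ] E => T v) hP.isIdempotentElem
  have h0 : ⟪P v, c • (v - P v)⟫_ℂ = 0 := by
    rw [inner_smul_right, inner_apply_left_of_isStarProjection hP, map_sub, hPP, sub_self,
      inner_zero_right, mul_zero]
  have := norm_add_sq_eq_norm_sq_add_norm_sq_of_inner_eq_zero _ _ h0
  rw [norm_smul] at this
  linear_combination this

theorem eq_of_norm_le_isStarProjection_add_smul {P : E →L[ℂ] E} (hP : IsStarProjection P) {c : ℂ}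
    (hc : ‖c‖ < 1) {v : E} (hv : ‖v‖ ≤ ‖P v + c • (v - P v)‖) : P v = v := by
  have h1 := norm_sq_isStarProjection_add_smul hP c v
  have h2 := norm_sq_isStarProjection_add_smul hP 1 v
  simp only [one_smul, add_sub_cancel, norm_one, one_pow, one_mul] at h2
  have h3 := pow_le_pow_left₀ (norm_nonneg v) hv 2
  have h4 : ‖c‖ ^ 2 < 1 := by have := norm_nonneg c; nlinarith
  have h5 : ‖v - P v‖ ^ 2 ≤ 0 := by
    by_contra! h
    nlinarith
  have h6 : ‖v - P v‖ = 0 := by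
    have := norm_nonneg (v - P v)
    exact pow_eq_zero_iff (two_ne_zero) |>.mp (le_antisymm h5 (by positivity))
  exact (sub_eq_zero.mp (norm_eq_zero.mp h6)).symm

end Projection

/-! ### Berger–Coburn–Lebow pairs -/

section Algebra

variable {R : Type*} [Ring R] [StarRing R] {s u P : R}

theorem bcl_mul (hu : star u * u = 1) (hP : IsIdempotentElem P) (hsP : Commute s P) :
    ((P + s * (1 - P)) * star u) * (u * ((1 - P) + s * P)) = s := by
  have hPs : P * s = s * P := hsP.eq.symm
  have hP' : P * P = P := hP
  calc ((P + s * (1 - P)) * star u) * (u * ((1 - P) + s * P))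
      = (P + s * (1 - P)) * (star u * u) * ((1 - P) + s * P) := by noncomm_ring
    _ = s := by
      rw [hu, mul_one]
      have h1 : (P + s * (1 - P)) * ((1 - P) + s * P) =
        P - P * P + P * s * P + s * (1 - P - P + P * P) + s * (s * P) - s * (P * s * P) := by
          noncomm_ring
      rw [h1, hPs, mul_assoc s P P, hP']
      noncomm_ring

theorem bcl_mul' (hu : u * star u = 1) (hP : IsIdempotentElem P) (hsP : Commute s P)
    (hsu : Commute s u) :
    (u * ((1 - P) + s * P)) * ((P + s * (1 - P)) * star u) = s := by
  have hPs : P * s = s * P := hsP.eq.symm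
  have hP' : P * P = P := hP
  have h1 : ((1 - P) + s * P) * (P + s * (1 - P)) = s := by
    have h1 : ((1 - P) + s * P) * (P + s * (1 - P)) =
        P - P * P + s * (P * P) + s - s * P - P * s + P * s * P + s * (P * s) - s * (P * s * P) := by
          noncomm_ring
    rw [h1, hPs, mul_assoc s P P, hP']
    noncomm_ring
  calc (u * ((1 - P) + s * P)) * ((P + s * (1 - P)) * star u)
      = u * (((1 - P) + s * P) * (P + s * (1 - P))) * star u := by noncomm_ring
    _ = s := by rw [h1, ← hsu.eq, mul_assoc, hu, mul_one]

theorem star_mul_add_mul_one_sub (hs : star s * s = 1) (hP : IsStarProjection P)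
    (hsP : Commute s P) :
    star (P + s * (1 - P)) * (P + s * (1 - P)) = 1 := by
  have hP' : P * P = P := hP.isIdempotentElem
  have hPs : star s * P = P * star s := by
    simpa [hP.isSelfAdjoint.star_eq] using congrArg star hsP.eq.symm
  have h1 : star (P + s * (1 - P)) * (P + s * (1 - P)) =
      P * P + P * s - (P * s) * P + star s * P - P * (star s * P) + (1 - P) * (star s * s) * (1 - P)
      := by
    simp only [star_add, star_mul, star_sub, star_one, hP.isSelfAdjoint.star_eq]
    noncomm_ring
  rw [h1, hs, hPs, ← hsP.eq, mul_assoc s P P, ← mul_assoc P P, hP']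
  noncomm_ring
  simp [hP']

theorem star_bcl_mul_self (hu : u * star u = 1) (hs : star s * s = 1) (hP : IsStarProjection P)
    (hsP : Commute s P) :
    star ((P + s * (1 - P)) * star u) * ((P + s * (1 - P)) * star u) = 1 := by
  rw [star_mul, star_star, mul_assoc, ← mul_assoc (star _) _ (star u),
    star_mul_add_mul_one_sub hs hP hsP, one_mul, hu]

theorem star_bcl_mul_self' (hu : star u * u = 1) (hs : star s * s = 1) (hP : IsStarProjection P)
    (hsP : Commute s P) :
    star (u * ((1 - P) + s * P)) * (u * ((1 - P) + s * P)) = 1 := by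
  have h := star_mul_add_mul_one_sub hs hP.one_sub ((Commute.one_right s).sub_right hsP)
  rw [sub_sub_cancel] at h
  rw [star_mul, mul_assoc, ← mul_assoc (star u), hu, one_mul, h]

end Algebra

section Dilation

variable {n : ℕ} {E : Type*} [NormedAddCommGroup E] [InnerProductSpace ℂ E] [CompleteSpace E]
  {p q : Fin n} (hpq : p ≠ q) (U P : E →L[ℂ] E)

/-- The multiplication operators with the symbols `dilationSymbol hpq U P`. -/
def dilationOp (i : Fin n) :
    HardySpace {i : Fin n // i ≠ q} E →L[ℂ] HardySpace {i : Fin n // i ≠ q} E :=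
  if hq : i = q then HardySpace.lift U * ((1 - HardySpace.lift P) +
    HardySpace.shift ⟨p, hpq⟩ * HardySpace.lift P)
  else if i = p then (HardySpace.lift P + HardySpace.shift ⟨p, hpq⟩ * (1 - HardySpace.lift P)) *
    star (HardySpace.lift U)
  else HardySpace.shift ⟨i, hq⟩

theorem isMultiplicationOperator_dilationOp (i : Fin n) :
    IsMultiplicationOperator (dilationSymbol hpq U P i) (dilationOp hpq U P i) := by
  intro f z
  unfold dilationOp dilationSymbol
  have h1 : (1 : HardySpace {i : Fin n // i ≠ q} E →L[ℂ] HardySpace {i : Fin n // i ≠ q} E) -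
    HardySpace.lift P = HardySpace.lift (1 - P) := by rw [map_sub, map_one]
  rw [h1, ← map_star]
  split_ifs
  · have h := (IsMultiplicationOperator.lift U).mul ((IsMultiplicationOperator.lift (1 - P)).add
      ((IsMultiplicationOperator.shift ⟨p, hpq⟩).mul (IsMultiplicationOperator.lift P))) f z
    simpa only [smul_mul_assoc, one_mul] using h
  · have h := ((IsMultiplicationOperator.lift P).add
      ((IsMultiplicationOperator.shift ⟨p, hpq⟩).mul (IsMultiplicationOperator.lift (1 - P)))).mul
      (IsMultiplicationOperator.lift (star U)) f z
    simpa only [smul_mul_assoc, one_mul] using h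
  · exact IsMultiplicationOperator.shift _ f z

variable {U P}

theorem star_mul_self_dilationOp (hU : U ∈ unitary (E →L[ℂ] E)) (hP : IsStarProjection P)
    (i : Fin n) : star (dilationOp hpq U P i) * dilationOp hpq U P i = 1 := by
  have h1 := Unitary.star_mul_self_of_mem
    (Unitary.map_mem (HardySpace.lift (ι := {i : Fin n // i ≠ q})) hU)
  have h2 := Unitary.mul_star_self_of_mem
    (Unitary.map_mem (HardySpace.lift (ι := {i : Fin n // i ≠ q})) hU)
  unfold dilationOp
  split_ifs
  · exact star_bcl_mul_self' h1 (HardySpace.star_shift_mul_shift _) (hP.map _)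
      (HardySpace.commute_shift_lift _ _)
  · exact star_bcl_mul_self h2 (HardySpace.star_shift_mul_shift _) (hP.map _)
      (HardySpace.commute_shift_lift _ _)
  · exact HardySpace.star_shift_mul_shift _

theorem commute_dilationOp (hU : U ∈ unitary (E →L[ℂ] E)) (hP : IsStarProjection P)
    (i j : Fin n) : Commute (dilationOp hpq U P i) (dilationOp hpq U P j) := by
  have h1 := Unitary.star_mul_self_of_mem
    (Unitary.map_mem (HardySpace.lift (ι := {i : Fin n // i ≠ q})) hU)
  have h2 := Unitary.mul_star_self_of_mem
    (Unitary.map_mem (HardySpace.lift (ι := {i : Fin n // i ≠ q})) hU)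
  let S : HardySpace {i : Fin n // i ≠ q} E →L[ℂ] HardySpace {i : Fin n // i ≠ q} E :=
    HardySpace.shift ⟨p, hpq⟩
  have hSP : Commute S (HardySpace.lift P) := HardySpace.commute_shift_lift _ _
  have hc := (bcl_mul h1 (hP.map HardySpace.lift).isIdempotentElem hSP).trans
    (bcl_mul' h2 (hP.map HardySpace.lift).isIdempotentElem hSP
      (HardySpace.commute_shift_lift _ _)).symm
  have hS : ∀ i : {i : Fin n // i ≠ q}, ∀ A : E →L[ℂ] E,
    Commute (HardySpace.shift i) (HardySpace.lift A) := HardySpace.commute_shift_lift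
  have hSS : ∀ i j : {i : Fin n // i ≠ q}, Commute
    (HardySpace.shift i : HardySpace {i : Fin n // i ≠ q} E →L[ℂ] _) (HardySpace.shift j) :=
      HardySpace.commute_shift_shift
  have hSq : ∀ i : {i : Fin n // i ≠ q}, Commute (HardySpace.shift i)
      (HardySpace.lift U * ((1 - HardySpace.lift P) +
        HardySpace.shift ⟨p, hpq⟩ * HardySpace.lift P)) := fun i =>
    (hS i U).mul_right (((Commute.one_right _).sub_right (hS i P)).add_right
      ((hSS i _).mul_right (hS i P)))
  have hSp : ∀ i : {i : Fin n // i ≠ q}, Commute (HardySpace.shift i)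
      ((HardySpace.lift P + HardySpace.shift ⟨p, hpq⟩ * (1 - HardySpace.lift P)) *
        star (HardySpace.lift U)) := fun i =>
    ((hS i P).add_right ((hSS i _).mul_right ((Commute.one_right _).sub_right (hS i P)))).mul_right
      (by rw [← map_star]; exact hS i _)
  unfold dilationOp
  split_ifs
  · exact Commute.refl _
  · exact Eq.symm hc
  · exact (hSq _).symm
  · exact hc
  · exact Commute.refl _
  · exact (hSp _).symm
  · exact hSq _
  · exact hSp _
  · exact hSS _ _

theorem coeff_star_dilationOp_right
    (f : HardySpace {i : Fin n // i ≠ q} E) (k : {i : Fin n // i ≠ q} → ℕ)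
    (hP : IsStarProjection P) :
    (star (dilationOp hpq U P q) f).coeff k =
      star U (f.coeff k) - P (star U (f.coeff k)) +
        P (star U (f.coeff (k + Pi.single ⟨p, hpq⟩ 1))) := by
  simp only [dilationOp, dite_true, star_mul, star_add, star_sub, star_one,
    ← map_star HardySpace.lift, hP.isSelfAdjoint.star_eq, HardySpace.star_shift]
  rfl

theorem coeff_star_dilationOp_left
    (f : HardySpace {i : Fin n // i ≠ q} E) (k : {i : Fin n // i ≠ q} → ℕ)
    (hP : IsStarProjection P) :
    (star (dilationOp hpq U P p) f).coeff k =
      U (P (f.coeff k) + (f.coeff (k + Pi.single ⟨p, hpq⟩ 1) -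
        P (f.coeff (k + Pi.single ⟨p, hpq⟩ 1)))) := by
  simp only [dilationOp, hpq, dite_false, if_true, star_mul, star_add, star_sub, star_one,
    star_star, ← map_star HardySpace.lift, hP.isSelfAdjoint.star_eq, HardySpace.star_shift]
  rfl

theorem coeff_star_dilationOp_of_ne {i : Fin n} (hp : i ≠ p) (hq : i ≠ q)
    (f : HardySpace {i : Fin n // i ≠ q} E) (k : {i : Fin n // i ≠ q} → ℕ) :
    (star (dilationOp hpq U P i) f).coeff k = f.coeff (k + Pi.single ⟨i, hq⟩ 1) := by
  simp [dilationOp, hp, hq, HardySpace.star_shift]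

theorem isometry_and_norm_le_one_of_star_mul_self {K : Type*} [NormedAddCommGroup K]
    [InnerProductSpace ℂ K] [CompleteSpace K] {T : K →L[ℂ] K} (hT : star T * T = 1) :
    Isometry T ∧ ‖T‖ ≤ 1 := by
  have h1 := (ContinuousLinearMap.norm_map_iff_adjoint_comp_self T).mpr hT
  exact ⟨AddMonoidHomClass.isometry_of_norm T h1,
    T.opNorm_le_bound zero_le_one fun x => by rw [h1, one_mul]⟩

theorem norm_pow_apply_le_of_norm_le_one {K : Type*} [NormedAddCommGroup K] [NormedSpace ℂ K]
    {T : K →L[ℂ] K} (hT : ‖T‖ ≤ 1) (m : ℕ) (x : K) : ‖(T ^ m) x‖ ≤ ‖x‖ := by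
  induction m with
  | zero => simp
  | succ m ih =>
    rw [pow_succ', mul_apply_eq_comp]
    exact (T.le_of_opNorm_le hT _).trans (by rwa [one_mul])

open Filter in
/-- Strong convergence to zero of the powers of a contraction can be tested on a set with dense
span. -/
theorem tendsto_pow_apply_of_dense_span {K : Type*} [NormedAddCommGroup K] [NormedSpace ℂ K]
    {T : K →L[ℂ] K} (hT : ‖T‖ ≤ 1) {s : Set K}
    (hs : (Submodule.span ℂ s).topologicalClosure = ⊤)
    (h : ∀ x ∈ s, Tendsto (fun m : ℕ => (T ^ m) x) atTop (nhds 0)) (x : K) :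
    Tendsto (fun m : ℕ => (T ^ m) x) atTop (nhds 0) := by
  have hspan : ∀ y ∈ Submodule.span ℂ s, Tendsto (fun m : ℕ => (T ^ m) y) atTop (nhds 0) := by
    intro y hy
    induction hy using Submodule.span_induction with
    | mem y hy => exact h y hy
    | zero => simp
    | add y z _ _ hy hz => simpa using hy.add hz
    | smul c y _ hy => simpa using hy.const_smul c
  rw [Metric.tendsto_atTop]
  intro ε hε
  have hx : x ∈ closure (Submodule.span ℂ s : Set K) := by
    rw [← Submodule.topologicalClosure_coe, hs]; trivial
  obtain ⟨y, hy, hxy⟩ := Metric.mem_closure_iff.mp hx (ε / 2) (by positivity)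
  obtain ⟨N, hN⟩ := Metric.tendsto_atTop.mp (hspan y hy) (ε / 2) (by positivity)
  refine ⟨N, fun m hm => ?_⟩
  have h1 := hN m hm
  have h2 := norm_pow_apply_le_of_norm_le_one hT m (x - y)
  rw [dist_eq_norm] at hxy
  rw [dist_zero_right] at h1 ⊢
  have h3 : (T ^ m) x = (T ^ m) (x - y) + (T ^ m) y := by rw [← map_add, sub_add_cancel]
  rw [h3]
  linarith [norm_add_le ((T ^ m) (x - y)) ((T ^ m) y)]

open Filter in
theorem IsMultiplicationOperator.isPureIsometry {ι : Type*} [Fintype ι]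
    {Φ : Polydisc ι → E →L[ℂ] E} {T : HardySpace ι E →L[ℂ] HardySpace ι E}
    (hT : IsMultiplicationOperator Φ T) (hTT : star T * T = 1)
    (hΦ : ∀ z, Tendsto (fun m : ℕ => star (Φ z) ^ m) atTop (nhds 0)) : IsPureIsometry T := by
  obtain ⟨h1, h2⟩ := isometry_and_norm_le_one_of_star_mul_self hTT
  refine ⟨h1, h2, fun f => ?_⟩
  refine tendsto_zero_iff_norm_tendsto_zero.mp ?_
  refine tendsto_pow_apply_of_dense_span (by rwa [norm_star])
    (RKHS.kerFun_dense (HardySpace ι E)) ?_ f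
  rintro _ ⟨z, v, rfl⟩
  simp only [hT.star_pow_apply_kerFun]
  have h3 := ((ContinuousLinearMap.apply ℂ E v).continuous.tendsto 0).comp (hΦ z)
  have h4 := ((RKHS.kerFun (HardySpace ι E) z).continuous.tendsto _).comp h3
  rwa [map_zero, map_zero] at h4

open Filter in
theorem tendsto_star_dilationSymbol_pow [FiniteDimensional ℂ E] (hU : U ∈ unitary (E →L[ℂ] E))
    (hP : IsStarProjection P)
    (hUP : ∀ (c : ℂ) (v : E), U v = c • v → P v = v ∨ P v = 0 → v = 0) (i : Fin n)
    (z : Polydisc {i : Fin n // i ≠ q}) :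
    Tendsto (fun m : ℕ => star (dilationSymbol hpq U P i z) ^ m) atTop (nhds 0) := by
  have hnU : ∀ v, ‖U v‖ = ‖v‖ :=
    (ContinuousLinearMap.norm_map_iff_adjoint_comp_self U).mpr (Unitary.star_mul_self_of_mem hU)
  have hnU' : ∀ v, ‖star U v‖ = ‖v‖ :=
    (ContinuousLinearMap.norm_map_iff_adjoint_comp_self (star U)).mpr (by
      rw [← ContinuousLinearMap.star_eq_adjoint, star_star]
      exact Unitary.mul_star_self_of_mem hU)
  have hUU : ∀ v, U (star U v) = v := fun v =>
    congrArg (fun T : E →L[ℂ] E => T v) (Unitary.mul_star_self_of_mem hU)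
  refine tendsto_pow_of_eigenvalue_norm_lt_one _ fun c v hv hcv => ?_
  by_contra! hc
  have hle : ‖v‖ ≤ ‖c • v‖ := by
    rw [norm_smul]; exact le_mul_of_one_le_left (norm_nonneg _) hc
  have hz := z.2 ⟨p, hpq⟩
  rw [← norm_star (z.1 ⟨p, hpq⟩)] at hz
  unfold dilationSymbol at hcv
  split_ifs at hcv with hi hi'
  · rw [star_mul, star_add, star_sub, star_one, star_smul, hP.isSelfAdjoint.star_eq] at hcv
    have h1 : (star U v - P (star U v)) + star (z.1 ⟨p, hpq⟩) • P (star U v) = c • v := hcv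
    have h2 := eq_of_norm_le_isStarProjection_add_smul hP.one_sub hz (v := star U v) (by
      rw [← h1, ← hnU'] at hle
      simpa [hnU'] using hle)
    have h3 : P (star U v) = 0 := by simpa using h2
    rw [h3, smul_zero, sub_zero, add_zero] at h1
    have hc0 : c ≠ 0 := by rintro rfl; norm_num at hc
    refine hv (hUP c⁻¹ v ?_ (Or.inr ?_))
    · rw [eq_inv_smul_iff₀ hc0, ← map_smul, ← h1, hUU]
    · rw [h1, map_smul] at h3
      exact (smul_eq_zero.mp h3).resolve_left hc0
  · rw [star_mul, star_star, star_add, star_smul, star_sub, star_one,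
      hP.isSelfAdjoint.star_eq] at hcv
    have h1 : U (P v + star (z.1 ⟨p, hpq⟩) • (v - P v)) = c • v := hcv
    have h2 := eq_of_norm_le_isStarProjection_add_smul hP hz (v := v) (by
      rwa [← h1, hnU] at hle)
    refine hv (hUP c v ?_ (Or.inl h2))
    rw [← h1, h2, sub_self, smul_zero, add_zero]
  · have h1 : star (z.1 ⟨i, hi⟩) • v = c • v := by simpa using hcv
    have h2 : star (z.1 ⟨i, hi⟩) = c := smul_left_injective ℂ hv h1
    have := z.2 ⟨i, hi⟩
    rw [← norm_star, h2] at this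
    linarith

theorem isPureIsometry_dilationOp [FiniteDimensional ℂ E] (hU : U ∈ unitary (E →L[ℂ] E))
    (hP : IsStarProjection P)
    (hUP : ∀ (c : ℂ) (v : E), U v = c • v → P v = v ∨ P v = 0 → v = 0) (i : Fin n) :
    IsPureIsometry (dilationOp hpq U P i) :=
  (isMultiplicationOperator_dilationOp hpq U P i).isPureIsometry
    (star_mul_self_dilationOp hpq hU hP i) (tendsto_star_dilationSymbol_pow hpq hU hP hUP i)

end Dilation

/-! ### The hereditary functional calculus -/

section Hereditary

open scoped IsMulCommutative in
/-- A commuting family defines a homomorphism of the polynomial algebra. -/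
theorem exists_algHom_of_commute {σ A : Type*} [Ring A] [Algebra ℂ A] (X : σ → A)
    (hX : ∀ i j, Commute (X i) (X j)) :
    ∃ φ : MvPolynomial σ ℂ →ₐ[ℂ] A, ∀ i, φ (MvPolynomial.X i) = X i := by
  have := Algebra.isMulCommutative_adjoin ℂ (s := Set.range X) (by
    rintro _ ⟨i, rfl⟩ _ ⟨j, rfl⟩; exact hX i j)
  let Y : σ → Algebra.adjoin ℂ (Set.range X) := fun i => ⟨X i, Algebra.subset_adjoin ⟨i, rfl⟩⟩
  exact ⟨(Algebra.adjoin ℂ (Set.range X)).val.comp (MvPolynomial.aeval Y), fun i => by simp [Y]⟩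

/-- The monomials with coefficient one. -/
abbrev monomialSubmonoid (σ : Type*) : Submonoid (MvPolynomial σ ℂ) :=
  MonoidHom.mrange (MvPolynomial.monomialOneHom ℂ σ)

theorem X_mem_monomialSubmonoid {σ : Type*} (i : σ) :
    (MvPolynomial.X i : MvPolynomial σ ℂ) ∈ monomialSubmonoid σ :=
  ⟨Multiplicative.ofAdd (Finsupp.single i 1), rfl⟩

theorem subsetProd_eq {σ κ H : Type*} [NormedAddCommGroup H] [InnerProductSpace ℂ H]
    [LinearOrder κ] (φ : MvPolynomial σ ℂ →ₐ[ℂ] (H →L[ℂ] H)) (y : κ → MvPolynomial σ ℂ)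
    (s : Finset κ) :
    subsetProd (fun i => φ (y i)) s = φ (∏ i ∈ s, y i) := by
  have h : (s.sort.map y).prod = ∏ i ∈ s, y i := by
    rw [Finset.prod, ← Finset.sort_eq s (· ≤ ·), Multiset.map_coe, Multiset.prod_coe]
  rw [← h, map_list_prod, List.map_map]
  rfl

variable {σ H : Type*} [NormedAddCommGroup H] [InnerProductSpace ℂ H] [CompleteSpace H]
  (φ : MvPolynomial σ ℂ →ₐ[ℂ] (H →L[ℂ] H))

/-- The linear map that sends the monomial `m` to `φ m * (φ m)*`. -/
def hereditary : MvPolynomial σ ℂ →ₗ[ℂ] (H →L[ℂ] H) :=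
  (MvPolynomial.basisMonomials σ ℂ).constr ℂ fun k =>
    φ (MvPolynomial.monomial k 1) * star (φ (MvPolynomial.monomial k 1))

theorem hereditary_of_mem {m : MvPolynomial σ ℂ} (hm : m ∈ monomialSubmonoid σ) :
    hereditary φ m = φ m * star (φ m) := by
  obtain ⟨k, rfl⟩ := hm
  have h := (MvPolynomial.basisMonomials σ ℂ).constr_basis ℂ
    (fun k => φ (MvPolynomial.monomial k 1) * star (φ (MvPolynomial.monomial k 1))) k.toAdd
  rwa [MvPolynomial.coe_basisMonomials] at h

theorem hereditary_mul {m : MvPolynomial σ ℂ} (hm : m ∈ monomialSubmonoid σ)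
    (f : MvPolynomial σ ℂ) : hereditary φ (m * f) = φ m * hereditary φ f * star (φ m) := by
  induction f using MvPolynomial.induction_on' with
  | monomial k c =>
    have hk : MvPolynomial.monomial k (1 : ℂ) ∈ monomialSubmonoid σ :=
      ⟨Multiplicative.ofAdd k, rfl⟩
    have h1 : MvPolynomial.monomial k c = c • MvPolynomial.monomial k (1 : ℂ) := by
      rw [MvPolynomial.smul_monomial, smul_eq_mul, mul_one]
    rw [h1, mul_smul_comm, map_smul, map_smul, hereditary_of_mem φ hk,
      hereditary_of_mem φ (mul_mem hm hk), map_mul, star_mul]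
    simp only [mul_smul_comm, smul_mul_assoc, mul_assoc]
  | add f g hf hg => rw [mul_add, map_add, map_add, hf, hg, mul_add, add_mul]

theorem re_inner_hereditary_mul {m : MvPolynomial σ ℂ} (hm : m ∈ monomialSubmonoid σ)
    (f : MvPolynomial σ ℂ) (h : H) : (⟪hereditary φ (m * f) h, h⟫_ℂ).re =
      (⟪hereditary φ f (star (φ m) h), star (φ m) h⟫_ℂ).re := by
  rw [hereditary_mul φ hm, ContinuousLinearMap.star_eq_adjoint,
    ContinuousLinearMap.adjoint_inner_right]
  rfl

theorem re_inner_hereditary_of_mem {m : MvPolynomial σ ℂ} (hm : m ∈ monomialSubmonoid σ) (h : H) :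
    (⟪hereditary φ m h, h⟫_ℂ).re = ‖star (φ m) h‖ ^ 2 := by
  have h1 : hereditary φ 1 = 1 := by simp [hereditary_of_mem φ (one_mem _)]
  have h2 := re_inner_hereditary_mul φ hm 1 h
  rw [mul_one, h1] at h2
  rw [h2]
  exact inner_self_eq_norm_sq (𝕜 := ℂ) _

variable {κ : Type*} {y : κ → MvPolynomial σ ℂ}

theorem szegoInv_eq_hereditary [Fintype κ] [LinearOrder κ] (hy : ∀ i, y i ∈ monomialSubmonoid σ) :
    szegoInv (fun i => φ (y i)) = hereditary φ (∏ i, (1 - y i)) := by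
  rw [Finset.prod_sub, map_sum, Finset.powerset_univ]
  refine Finset.sum_congr rfl fun s _ => ?_
  rw [subsetProd_eq, ← hereditary_of_mem φ (prod_mem fun i _ => hy i), ← map_smul,
    Finset.prod_const_one, mul_one, MvPolynomial.smul_eq_C_mul]
  simp

open Filter in
/-- For a pure tuple the iterates of the defect operator sum up to the identity. -/
theorem hasSum_re_inner_hereditary [Fintype κ] [DecidableEq κ]
    (hy : ∀ i, y i ∈ monomialSubmonoid σ)
    (hnorm : ∀ m ∈ monomialSubmonoid σ, ‖φ m‖ ≤ 1)
    (hpure : ∀ i h, Tendsto (fun N : ℕ => ‖(star (φ (y i)) ^ N) h‖) atTop (nhds 0))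
    (hpos : ∀ h, 0 ≤ (⟪hereditary φ (∏ i, (1 - y i)) h, h⟫_ℂ).re) (h : H) :
    HasSum (fun k : κ → ℕ => (⟪hereditary φ (∏ i, (1 - y i)) (star (φ (∏ i, y i ^ k i)) h),
      star (φ (∏ i, y i ^ k i)) h⟫_ℂ).re) (‖h‖ ^ 2) := by
  let F : MvPolynomial σ ℂ → ℝ := fun f => (⟪hereditary φ f h, h⟫_ℂ).re
  have hFsum : ∀ {α : Type _} (s : Finset α) (g : α → MvPolynomial σ ℂ),
      F (∑ a ∈ s, g a) = ∑ a ∈ s, F (g a) := fun s g => by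
    simp [F, map_sum]
  have hk : ∀ k : κ → ℕ, ∏ i, y i ^ k i ∈ monomialSubmonoid σ := fun k =>
    prod_mem fun i _ => pow_mem (hy i) _
  let a : (κ → ℕ) → ℝ := fun k => F ((∏ i, y i ^ k i) * ∏ i, (1 - y i))
  have ha : ∀ k, a k = (⟪hereditary φ (∏ i, (1 - y i)) (star (φ (∏ i, y i ^ k i)) h),
      star (φ (∏ i, y i ^ k i)) h⟫_ℂ).re := fun k => re_inner_hereditary_mul φ (hk k) _ h
  have ha0 : ∀ k, 0 ≤ a k := fun k => (ha k).symm ▸ hpos _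
  simp only [← ha]
  let B : ℕ → Finset (κ → ℕ) := fun N => Fintype.piFinset fun _ => Finset.range N
  have hBm : Monotone B := fun M N hMN =>
    Fintype.piFinset_subset _ _ fun _ => Finset.range_mono hMN
  have hBt : Tendsto B atTop atTop := tendsto_atTop_finset_of_monotone hBm fun k =>
    ⟨Finset.univ.sup k + 1, by
      simp only [B, Fintype.mem_piFinset, Finset.mem_range]
      intro i
      exact Nat.lt_succ_of_le (Finset.le_sup (Finset.mem_univ i))⟩
  have hBs : ∀ N, ∑ k ∈ B N, a k =
      ∑ s : Finset κ, (-1) ^ s.card * ‖star (φ (∏ i ∈ s, y i ^ N)) h‖ ^ 2 := by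
    intro N
    have h1 : ∑ k ∈ B N, (∏ i, y i ^ k i) * ∏ i, (1 - y i) = ∏ i, (1 - y i ^ N) := by
      rw [← Finset.sum_mul, ← Finset.prod_univ_sum (fun _ => Finset.range N) fun i j => y i ^ j,
        ← Finset.prod_mul_distrib]
      exact Finset.prod_congr rfl fun i _ => by rw [mul_comm, mul_neg_geom_sum]
    rw [← hFsum, h1, Finset.prod_sub, Finset.powerset_univ, hFsum]
    refine Finset.sum_congr rfl fun s _ => ?_
    rw [← re_inner_hereditary_of_mem φ (prod_mem fun i _ => pow_mem (hy i) N),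
      Finset.prod_const_one, mul_one]
    rcases Nat.even_or_odd s.card with hs | hs <;> simp [F, hs.neg_one_pow]
  have hlim : Tendsto (fun N => ∑ k ∈ B N, a k) atTop (nhds (‖h‖ ^ 2)) := by
    simp only [hBs]
    have h1 : ∀ s : Finset κ, Tendsto
        (fun N : ℕ => (-1 : ℝ) ^ s.card * ‖star (φ (∏ i ∈ s, y i ^ N)) h‖ ^ 2) atTop
        (nhds (if s = ∅ then ‖h‖ ^ 2 else 0)) := fun s => by
      split_ifs with hs
      · subst hs; simp
      · obtain ⟨i, hi⟩ := Finset.nonempty_iff_ne_empty.mpr hs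
        have h2 : Tendsto (fun N : ℕ => ‖star (φ (∏ i ∈ s, y i ^ N)) h‖) atTop (nhds 0) := by
          refine squeeze_zero (fun _ => norm_nonneg _) (fun N => ?_) (hpure i h)
          rw [← Finset.mul_prod_erase s _ hi, map_mul, star_mul, map_pow, star_pow,
            mul_apply_eq_comp]
          refine (ContinuousLinearMap.le_of_opNorm_le _ (c := 1) ?_ _).trans (by rw [one_mul])
          rw [norm_star]
          exact hnorm _ (prod_mem fun i _ => pow_mem (hy i) N)
        simpa using (h2.pow 2).const_mul ((-1 : ℝ) ^ s.card)
    simpa using tendsto_finsetSum Finset.univ fun s _ => h1 s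
  have hle : ∀ N, ∑ k ∈ B N, a k ≤ ‖h‖ ^ 2 :=
    (Finset.sum_mono_set_of_nonneg ha0 |>.comp hBm).ge_of_tendsto hlim
  have hsum : Summable a := summable_of_sum_le ha0 fun u => by
    obtain ⟨N, hN⟩ := (hBt.eventually_ge_atTop u).exists
    exact (Finset.sum_le_sum_of_subset_of_nonneg hN fun k _ _ => ha0 k).trans (hle N)
  have := tendsto_nhds_unique (hsum.hasSum.comp hBt) hlim
  exact this ▸ hsum.hasSum

end Hereditary

/-! ### Reduction of a model space -/

section Reduction

variable {E : Type*} [NormedAddCommGroup E] [InnerProductSpace ℂ E] [CompleteSpace E]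
  {H : Type*} [NormedAddCommGroup H] [InnerProductSpace ℂ H]

/-- `S` contains the range of `W` and reduces `U` and `P`. -/
structure IsReducingFor (U P : E →L[ℂ] E) (W : H →L[ℂ] E) (S : Submodule ℂ E) : Prop where
  range_mem : ∀ h, W h ∈ S
  unitary_mem : ∀ x ∈ S, U x ∈ S
  star_mem : ∀ x ∈ S, star U x ∈ S
  proj_mem : ∀ x ∈ S, P x ∈ S

theorem isReducingFor_sInf (U P : E →L[ℂ] E) (W : H →L[ℂ] E) :
    IsReducingFor U P W (sInf {S | IsReducingFor U P W S}) where
  range_mem h := Submodule.mem_sInf.mpr fun _ hS => hS.range_mem h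
  unitary_mem x hx := Submodule.mem_sInf.mpr fun S hS =>
    hS.unitary_mem x (Submodule.mem_sInf.mp hx S hS)
  star_mem x hx := Submodule.mem_sInf.mpr fun S hS =>
    hS.star_mem x (Submodule.mem_sInf.mp hx S hS)
  proj_mem x hx := Submodule.mem_sInf.mpr fun S hS =>
    hS.proj_mem x (Submodule.mem_sInf.mp hx S hS)

open Filter in
theorem eq_zero_of_norm_apply_eq {A : H →L[ℂ] H} (l : H →L[ℂ] ℂ)
    (hA : ∀ h, Tendsto (fun m : ℕ => ‖(A ^ m) h‖) atTop (nhds 0)) (hl : ∀ h, ‖l (A h)‖ = ‖l h‖)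
    (h : H) : l h = 0 := by
  have h1 : ∀ m : ℕ, ‖l ((A ^ m) h)‖ = ‖l h‖ := fun m => by
    induction m with
    | zero => simp
    | succ m ih => rw [pow_succ', mul_apply_eq_comp, hl, ih]
  have h2 := (l.continuous.tendsto 0).comp (tendsto_zero_iff_norm_tendsto_zero.mpr (hA h))
  have h3 := h2.norm
  simp only [map_zero, norm_zero, Function.comp_apply, h1] at h3
  exact norm_eq_zero.mp (tendsto_nhds_unique tendsto_const_nhds h3)

variable {U P : E →L[ℂ] E} {W : H →L[ℂ] E} {A B : H →L[ℂ] H}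

theorem norm_eq_one_of_apply_eq_smul (hU : U ∈ unitary (E →L[ℂ] E)) {c : ℂ} {v : E} (hv : v ≠ 0)
    (hc : U v = c • v) : ‖c‖ = 1 := by
  have h1 := (ContinuousLinearMap.norm_map_iff_adjoint_comp_self U).mpr
    (Unitary.star_mul_self_of_mem hU) v
  rw [hc, norm_smul] at h1
  exact (mul_eq_right₀ (norm_ne_zero_iff.mpr hv)).mp h1

theorem conj_mul_inner_of_apply_eq_smul (hU : U ∈ unitary (E →L[ℂ] E)) {c : ℂ} {v : E}
    (hc : U v = c • v) (x : E) : starRingEnd ℂ c * ⟪v, U x⟫_ℂ = ⟪v, x⟫_ℂ := by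
  rw [← inner_smul_left, ← hc]
  exact (ContinuousLinearMap.inner_map_map_iff_adjoint_comp_self U).mpr
    (Unitary.star_mul_self_of_mem hU) v x

open Filter in
theorem inner_eq_zero_of_apply_eq_smul (hU : U ∈ unitary (E →L[ℂ] E)) (hP : IsStarProjection P)
    (hA : ∀ h, Tendsto (fun m : ℕ => ‖(A ^ m) h‖) atTop (nhds 0))
    (hB : ∀ h, Tendsto (fun m : ℕ => ‖(B ^ m) h‖) atTop (nhds 0))
    (hWA : ∀ h, W (A h) = U (P (W h) + (W (A (B h)) - P (W (A (B h))))))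
    (hWB : ∀ h, W (B h) = star U (W h) - P (star U (W h)) + P (star U (W (A (B h)))))
    {c : ℂ} {v : E} (hc : U v = c • v) (hv : P v = v ∨ P v = 0) (h : H) : ⟪v, W h⟫_ℂ = 0 := by
  by_cases hv0 : v = 0
  · rw [hv0, inner_zero_left]
  have hc1 := norm_eq_one_of_apply_eq_smul hU hv0 hc
  rcases hv with hv | hv
  · refine eq_zero_of_norm_apply_eq ((innerSL ℂ v) ∘L W) hA (fun h => ?_) h
    have h1 := conj_mul_inner_of_apply_eq_smul hU hc (P (W h) + (W (A (B h)) - P (W (A (B h)))))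
    rw [← hWA, inner_add_right, inner_sub_right, ← inner_apply_left_of_isStarProjection hP,
      ← inner_apply_left_of_isStarProjection hP, hv, sub_self, add_zero] at h1
    change ‖⟪v, W (A h)⟫_ℂ‖ = ‖⟪v, W h⟫_ℂ‖
    rw [← h1, norm_mul, RCLike.norm_conj, hc1, one_mul]
  · refine eq_zero_of_norm_apply_eq ((innerSL ℂ v) ∘L W) hB (fun h => ?_) h
    change ‖⟪v, W (B h)⟫_ℂ‖ = ‖⟪v, W h⟫_ℂ‖
    rw [hWB, inner_add_right, inner_sub_right, ← inner_apply_left_of_isStarProjection hP,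
      ← inner_apply_left_of_isStarProjection hP, hv, inner_zero_left, inner_zero_left, sub_zero,
      add_zero, ContinuousLinearMap.star_eq_adjoint, ContinuousLinearMap.adjoint_inner_right, hc,
      inner_smul_left, norm_mul, RCLike.norm_conj, hc1, one_mul]

open Filter in
theorem eq_zero_of_mem_sInf_isReducingFor (hU : U ∈ unitary (E →L[ℂ] E)) (hP : IsStarProjection P)
    (hA : ∀ h, Tendsto (fun m : ℕ => ‖(A ^ m) h‖) atTop (nhds 0))
    (hB : ∀ h, Tendsto (fun m : ℕ => ‖(B ^ m) h‖) atTop (nhds 0))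
    (hWA : ∀ h, W (A h) = U (P (W h) + (W (A (B h)) - P (W (A (B h))))))
    (hWB : ∀ h, W (B h) = star U (W h) - P (star U (W h)) + P (star U (W (A (B h)))))
    {c : ℂ} {v : E} (hvS : v ∈ sInf {S | IsReducingFor U P W S})
    (hc : U v = c • v) (hv : P v = v ∨ P v = 0) : v = 0 := by
  by_contra hv0
  have hc1 := norm_eq_one_of_apply_eq_smul hU hv0 hc
  have hc0 : starRingEnd ℂ c ≠ 0 := by
    rw [← norm_ne_zero_iff, RCLike.norm_conj, hc1]; exact one_ne_zero
  have hS : IsReducingFor U P W (Submodule.span ℂ {v})ᗮ := by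
    refine ⟨fun h => ?_, fun x hx => ?_, fun x hx => ?_, fun x hx => ?_⟩
    all_goals
      rw [Submodule.mem_orthogonal_singleton_iff_inner_right] at *
    · exact inner_eq_zero_of_apply_eq_smul hU hP hA hB hWA hWB hc hv h
    · have := conj_mul_inner_of_apply_eq_smul hU hc x
      rw [hx] at this
      exact (mul_eq_zero.mp this).resolve_left hc0
    · rw [ContinuousLinearMap.star_eq_adjoint, ContinuousLinearMap.adjoint_inner_right, hc,
        inner_smul_left, hx, mul_zero]
    · rw [← inner_apply_left_of_isStarProjection hP]
      rcases hv with hv | hv <;> simp [hv, hx]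
  have h1 := Submodule.mem_sInf.mp hvS _ hS
  rw [Submodule.mem_orthogonal_singleton_iff_inner_right, inner_self_eq_zero] at h1
  exact hv0 h1

open Filter in
/-- A finite dimensional model can be cut down to one without unimodular eigenvectors of `U` that
are fixed or annihilated by `P`. -/
theorem exists_reduced_model [FiniteDimensional ℂ E] (hU : U ∈ unitary (E →L[ℂ] E))
    (hP : IsStarProjection P)
    (hA : ∀ h, Tendsto (fun m : ℕ => ‖(A ^ m) h‖) atTop (nhds 0))
    (hB : ∀ h, Tendsto (fun m : ℕ => ‖(B ^ m) h‖) atTop (nhds 0))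
    (hWA : ∀ h, W (A h) = U (P (W h) + (W (A (B h)) - P (W (A (B h))))))
    (hWB : ∀ h, W (B h) = star U (W h) - P (star U (W h)) + P (star U (W (A (B h))))) :
    ∃ (S : Submodule ℂ E) (U' P' : S →L[ℂ] S) (W' : H →L[ℂ] S),
      U' ∈ unitary (S →L[ℂ] S) ∧ IsStarProjection P' ∧ (∀ h, ‖W' h‖ = ‖W h‖) ∧
      (∀ h, W' (A h) = U' (P' (W' h) + (W' (A (B h)) - P' (W' (A (B h)))))) ∧
      (∀ h, W' (B h) = star U' (W' h) - P' (star U' (W' h)) + P' (star U' (W' (A (B h))))) ∧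
      ∀ (c : ℂ) (v : S), U' v = c • v → P' v = v ∨ P' v = 0 → v = 0 := by
  let S := sInf {S | IsReducingFor U P W S}
  have hS : IsReducingFor U P W S := isReducingFor_sInf U P W
  let U' : S →L[ℂ] S := (U ∘L S.subtypeL).codRestrict S fun x => hS.unitary_mem x x.2
  let Us : S →L[ℂ] S := (star U ∘L S.subtypeL).codRestrict S fun x => hS.star_mem x x.2
  let P' : S →L[ℂ] S := (P ∘L S.subtypeL).codRestrict S fun x => hS.proj_mem x x.2
  let W' : H →L[ℂ] S := W.codRestrict S hS.range_mem
  have hUs : star U' = Us := by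
    rw [ContinuousLinearMap.star_eq_adjoint, eq_comm, ContinuousLinearMap.eq_adjoint_iff]
    intro x y
    change ⟪star U (x : E), (y : E)⟫_ℂ = ⟪(x : E), U (y : E)⟫_ℂ
    rw [ContinuousLinearMap.star_eq_adjoint, ContinuousLinearMap.adjoint_inner_left]
  have hU1 : ∀ v, star U (U v) = v := fun v =>
    congrArg (fun T : E →L[ℂ] E => T v) (Unitary.star_mul_self_of_mem hU)
  have hU2 : ∀ v, U (star U v) = v := fun v =>
    congrArg (fun T : E →L[ℂ] E => T v) (Unitary.mul_star_self_of_mem hU)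
  have hPP : ∀ v, P (P v) = P v := fun v =>
    congrArg (fun T : E →L[ℂ] E => T v) hP.isIdempotentElem
  refine ⟨S, U', P', W', ?_, ⟨?_, ?_⟩, fun h => rfl, fun h => ?_, fun h => ?_, fun c v hc hv => ?_⟩
  · rw [Unitary.mem_iff, hUs]
    exact ⟨by ext x; exact hU1 x, by ext x; exact hU2 x⟩
  · ext x; exact hPP x
  · rw [IsSelfAdjoint, ContinuousLinearMap.star_eq_adjoint, eq_comm,
      ContinuousLinearMap.eq_adjoint_iff]
    exact fun x y => inner_apply_left_of_isStarProjection hP (x : E) y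
  · exact Subtype.ext (hWA h)
  · rw [hUs]; exact Subtype.ext (hWB h)
  · refine Subtype.ext (eq_zero_of_mem_sInf_isReducingFor hU hP hA hB hWA hWB v.2
      (congrArg Subtype.val hc) ?_)
    exact hv.imp (congrArg Subtype.val) (congrArg Subtype.val)

end Reduction

/-! ### The model of a finite rank tuple -/

section Model

variable {H : Type*} [NormedAddCommGroup H] [InnerProductSpace ℂ H]

section Pair

variable {K L : Type*} [NormedAddCommGroup K] [InnerProductSpace ℂ K] [NormedAddCommGroup L]
  [InnerProductSpace ℂ L]

/-- The operator `h ↦ (S h, T h)` into the Hilbert sum. -/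
def pairMap (S : H →L[ℂ] K) (T : H →L[ℂ] L) : H →L[ℂ] WithLp 2 (K × L) :=
  (WithLp.prodContinuousLinearEquiv 2 ℂ K L).symm.toContinuousLinearMap ∘L S.prod T

theorem pairMap_apply (S : H →L[ℂ] K) (T : H →L[ℂ] L) (h : H) :
    pairMap S T h = WithLp.toLp 2 (S h, T h) := rfl

theorem norm_sq_pairMap (S : H →L[ℂ] K) (T : H →L[ℂ] L) (h : H) :
    ‖pairMap S T h‖ ^ 2 = ‖S h‖ ^ 2 + ‖T h‖ ^ 2 := by
  rw [WithLp.prod_norm_sq_eq_of_L2]; rfl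

/-- The projection of a Hilbert sum onto the first summand. -/
def fstProj (K L : Type*) [NormedAddCommGroup K] [InnerProductSpace ℂ K] [NormedAddCommGroup L]
    [InnerProductSpace ℂ L] : WithLp 2 (K × L) →L[ℂ] WithLp 2 (K × L) :=
  pairMap (WithLp.fstL 2 ℂ K L) 0

theorem fstProj_toLp (x : K) (y : L) : fstProj K L (WithLp.toLp 2 (x, y)) = WithLp.toLp 2 (x, 0) :=
  rfl

theorem isStarProjection_fstProj [CompleteSpace K] [CompleteSpace L] :
    IsStarProjection (fstProj K L) := by
  refine ⟨ContinuousLinearMap.ext fun x => rfl, ?_⟩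
  rw [IsSelfAdjoint, ContinuousLinearMap.star_eq_adjoint, eq_comm,
    ContinuousLinearMap.eq_adjoint_iff]
  intro x y
  rw [WithLp.prod_inner_apply, WithLp.prod_inner_apply]
  simp [fstProj, pairMap_apply]

/-- The unitary dilation data on the Hilbert sum of two finite dimensional defect spaces. -/
theorem exists_model [FiniteDimensional ℂ K] [FiniteDimensional ℂ L] [CompleteSpace K]
    [CompleteSpace L] (S : H →L[ℂ] K) (T : H →L[ℂ] L) (A B : H →L[ℂ] H) (hAB : Commute A B)
    (hST : ∀ h, ‖S h‖ ^ 2 + ‖T (B h)‖ ^ 2 = ‖S (A h)‖ ^ 2 + ‖T h‖ ^ 2) :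
    ∃ (U P : WithLp 2 (K × L) →L[ℂ] WithLp 2 (K × L)) (W : H →L[ℂ] WithLp 2 (K × L)),
      U ∈ unitary (WithLp 2 (K × L) →L[ℂ] WithLp 2 (K × L)) ∧ IsStarProjection P ∧
      (∀ h, ‖W h‖ ^ 2 = ‖S (A h)‖ ^ 2 + ‖T h‖ ^ 2) ∧
      (∀ h, W (A h) = U (P (W h) + (W (A (B h)) - P (W (A (B h)))))) ∧
      (∀ h, W (B h) = star U (W h) - P (star U (W h)) + P (star U (W (A (B h))))) := by
  have hAB' : ∀ h, A (B h) = B (A h) := fun h => congrArg (fun R : H →L[ℂ] H => R h) hAB.eq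
  let W := pairMap (S ∘L A) T
  let W' := pairMap S (T ∘L B)
  obtain ⟨U, hU, hUW⟩ := exists_unitary_of_norm_eq W'.toLinearMap W.toLinearMap fun h => by
    refine (sq_eq_sq₀ (norm_nonneg _) (norm_nonneg _)).mp ?_
    exact (norm_sq_pairMap S (T ∘L B) h).trans
      ((hST h).trans (norm_sq_pairMap (S ∘L A) T h).symm)
  have h1 : ∀ h, U (W' h) = W h := hUW
  have h2 : ∀ h, star U (W h) = W' h := fun h => by
    rw [← h1]
    exact congrArg (fun R : WithLp 2 (K × L) →L[ℂ] WithLp 2 (K × L) => R (W' h))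
      (Unitary.star_mul_self_of_mem hU)
  refine ⟨U, fstProj K L, W, hU, isStarProjection_fstProj, norm_sq_pairMap _ _, fun h => ?_,
    fun h => ?_⟩
  · rw [← h1]
    congr 1
    simp only [W, W', pairMap_apply, fstProj_toLp, ← WithLp.toLp_sub, ← WithLp.toLp_add,
      Prod.mk_sub_mk, Prod.mk_add_mk, ContinuousLinearMap.comp_apply, hAB', sub_self, add_zero,
      sub_zero, zero_add]
  · simp only [h2]
    simp only [W, W', pairMap_apply, fstProj_toLp, ← WithLp.toLp_sub, ← WithLp.toLp_add,
      Prod.mk_sub_mk, Prod.mk_add_mk, ContinuousLinearMap.comp_apply, sub_self, add_zero,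
      sub_zero, zero_add]

end Pair

variable [CompleteSpace H]

theorem norm_sq_sqrt_apply {T : H →L[ℂ] H} (hT : T.IsPositive) (h : H) :
    ‖CFC.sqrt T h‖ ^ 2 = (⟪T h, h⟫_ℂ).re := by
  have h0 : 0 ≤ T := (ContinuousLinearMap.nonneg_iff_isPositive T).mpr hT
  have h1 : IsSelfAdjoint (CFC.sqrt T) := (CFC.sqrt_nonneg T).isSelfAdjoint
  conv_rhs => rw [← CFC.sqrt_mul_sqrt_self T h0, mul_apply_eq_comp]
  rw [← ContinuousLinearMap.adjoint_inner_right, ← ContinuousLinearMap.star_eq_adjoint,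
    h1.star_eq]
  exact (inner_self_eq_norm_sq (𝕜 := ℂ) _).symm

/-- The defect operator as a map into the defect space. -/
def defectOp {ι : Type*} [Fintype ι] [LinearOrder ι] (X : ι → H →L[ℂ] H) :
    H →L[ℂ] defectSpace X :=
  (CFC.sqrt (szegoInv X)).codRestrict (defectSpace X) fun h =>
    Submodule.le_topologicalClosure _ ⟨h, rfl⟩

theorem norm_sq_defectOp {ι : Type*} [Fintype ι] [LinearOrder ι] {X : ι → H →L[ℂ] H}
    (hX : IsSzegoTuple X) (h : H) : ‖defectOp X h‖ ^ 2 = (⟪szegoInv X h, h⟫_ℂ).re :=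
  norm_sq_sqrt_apply hX.2 h

theorem norm_le_one_of_mem_monomialSubmonoid {σ : Type*}
    (φ : MvPolynomial σ ℂ →ₐ[ℂ] (H →L[ℂ] H)) (hφ : ∀ i, ‖φ (MvPolynomial.X i)‖ ≤ 1)
    {m : MvPolynomial σ ℂ} (hm : m ∈ monomialSubmonoid σ) : ‖φ m‖ ≤ 1 := by
  let M : Submonoid (MvPolynomial σ ℂ) :=
    { carrier := {f | ‖φ f‖ ≤ 1}
      one_mem' := by rw [Set.mem_ofPred_eq, map_one]; exact ContinuousLinearMap.norm_id_le
      mul_mem' := fun {f g} hf hg => by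
        rw [Set.mem_ofPred_eq, map_mul]
        exact (norm_mul_le _ _).trans (mul_le_one₀ hf (norm_nonneg _) hg) }
  obtain ⟨k, rfl⟩ := hm
  change MvPolynomial.monomial k.toAdd 1 ∈ M
  rw [MvPolynomial.monomial_eq, map_one, one_mul]
  exact prod_mem fun i _ => pow_mem (show _ ∈ M from hφ i) _

section Fin

variable {n : ℕ}

theorem prod_subtype_ne {M : Type*} [CommMonoid M] {p q : Fin n} (hpq : p ≠ q) (f : Fin n → M) :
    ∏ i : {i : Fin n // i ≠ q}, f i = f p * ∏ i ∈ (Finset.univ.erase q).erase p, f i := by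
  rw [Finset.mul_prod_erase _ _ (by simp [hpq])]
  exact (Finset.prod_subtype _ (by simp) f).symm

/-- The polynomials that define the tuple with the entries `X i`, `i ≠ p, q`, and `X p * X q`. -/
def mergedPoly (p q i : Fin n) : MvPolynomial (Fin n) ℂ :=
  if i = p then MvPolynomial.X p * MvPolynomial.X q else MvPolynomial.X i

theorem mergedPoly_mem (p q i : Fin n) : mergedPoly p q i ∈ monomialSubmonoid (Fin n) := by
  unfold mergedPoly
  split_ifs
  · exact mul_mem (X_mem_monomialSubmonoid _) (X_mem_monomialSubmonoid _)
  · exact X_mem_monomialSubmonoid _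

theorem prod_one_sub_mergedPoly {p q : Fin n} (hpq : p ≠ q) :
    ∏ i : {i : Fin n // i ≠ q}, (1 - mergedPoly p q i) =
      MvPolynomial.X p * ∏ i : {i : Fin n // i ≠ p}, (1 - MvPolynomial.X (i : Fin n)) +
        ∏ i : {i : Fin n // i ≠ q}, (1 - MvPolynomial.X (i : Fin n)) ∧
    ∏ i : {i : Fin n // i ≠ q}, (1 - mergedPoly p q i) =
      ∏ i : {i : Fin n // i ≠ p}, (1 - MvPolynomial.X (i : Fin n)) +
        MvPolynomial.X q * ∏ i : {i : Fin n // i ≠ q}, (1 - MvPolynomial.X (i : Fin n)) := by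
  have h1 := prod_subtype_ne hpq fun i => 1 - mergedPoly p q i
  have h2 := prod_subtype_ne hpq fun i => 1 - (MvPolynomial.X i : MvPolynomial (Fin n) ℂ)
  have h3 := prod_subtype_ne hpq.symm fun i => 1 - (MvPolynomial.X i : MvPolynomial (Fin n) ℂ)
  have h4 : ∏ i ∈ (Finset.univ.erase q).erase p, (1 - mergedPoly p q i) =
      ∏ i ∈ (Finset.univ.erase q).erase p, (1 - MvPolynomial.X i) :=
    Finset.prod_congr rfl fun i hi => by
      rw [mergedPoly, if_neg (Finset.ne_of_mem_erase hi)]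
  rw [h4, mergedPoly, if_pos rfl] at h1
  rw [Finset.erase_right_comm] at h3
  rw [h1, h2, h3]
  constructor <;> ring

open Filter in
/-- The canonical isometry into the Hardy space. -/
theorem exists_isometry_hardySpace {σ κ E : Type*} [Fintype κ] [DecidableEq κ]
    [NormedAddCommGroup E] [InnerProductSpace ℂ E]
    (φ : MvPolynomial σ ℂ →ₐ[ℂ] (H →L[ℂ] H)) {y : κ → MvPolynomial σ ℂ}
    (hy : ∀ i, y i ∈ monomialSubmonoid σ)
    (hnorm : ∀ m ∈ monomialSubmonoid σ, ‖φ m‖ ≤ 1)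
    (hpure : ∀ i h, Tendsto (fun N : ℕ => ‖(star (φ (y i)) ^ N) h‖) atTop (nhds 0))
    (W : H →L[ℂ] E) (hW : ∀ h, ‖W h‖ ^ 2 = (⟪hereditary φ (∏ i, (1 - y i)) h, h⟫_ℂ).re) :
    ∃ J : H →ₗᵢ[ℂ] HardySpace κ E,
      ∀ h k, (J h).coeff k = W (star (φ (∏ i, y i ^ k i)) h) := by
  have hs : ∀ h, HasSum (fun k : κ → ℕ => ‖W (star (φ (∏ i, y i ^ k i)) h)‖ ^ 2) (‖h‖ ^ 2) :=
    fun h => by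
      simp only [hW]
      exact hasSum_re_inner_hereditary φ hy hnorm hpure (fun h => hW h ▸ by positivity) h
  refine ⟨⟨⟨⟨fun h => HardySpace.ofCoeff _ (hs h).summable, fun f g => ?_⟩, fun c f => ?_⟩,
    fun h => ?_⟩, fun h k => rfl⟩
  · ext k; simp
  · ext k; simp
  · refine (sq_eq_sq₀ (norm_nonneg _) (norm_nonneg _)).mp ?_
    exact (HardySpace.hasSum_norm_sq _).unique (hs h)

/-- The canonical isometry of a model intertwines `X i` and the `i`-th dilating operator. -/
theorem exists_intertwining_isometry {E : Type*} [NormedAddCommGroup E] [InnerProductSpace ℂ E]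
    [CompleteSpace E] {p q : Fin n} (hpq : p ≠ q) {X : Fin n → H →L[ℂ] H}
    (hXc : IsCommutingContractive X) (hpure : ∀ i, IsPureContraction (X i))
    {φ : MvPolynomial (Fin n) ℂ →ₐ[ℂ] (H →L[ℂ] H)} (hφ : ∀ i, φ (MvPolynomial.X i) = X i)
    {U P : E →L[ℂ] E} (hP : IsStarProjection P) (W : H →L[ℂ] E)
    (hW : ∀ h, ‖W h‖ ^ 2 = (⟪hereditary φ
      (∏ i : {i : Fin n // i ≠ q}, (1 - mergedPoly p q i)) h, h⟫_ℂ).re)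
    (hA : ∀ h, W (star (X p) h) = U (P (W h) +
      (W (star (X p) (star (X q) h)) - P (W (star (X p) (star (X q) h))))))
    (hB : ∀ h, W (star (X q) h) = star U (W h) - P (star U (W h)) +
      P (star U (W (star (X p) (star (X q) h))))) :
    ∃ J : H →ₗᵢ[ℂ] HardySpace {i : Fin n // i ≠ q} E,
      ∀ i h, J (star (X i) h) = star (dilationOp hpq U P i) (J h) := by
  have hcomm : ∀ i j, Commute (star (X i)) (star (X j)) := fun i j => (hXc.2 i j).star_star
  have hnorm : ∀ m ∈ monomialSubmonoid (Fin n), ‖φ m‖ ≤ 1 := fun m hm =>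
    norm_le_one_of_mem_monomialSubmonoid φ (fun i => by rw [hφ]; exact hXc.1 i) hm
  have hφm : ∀ i : {i : Fin n // i ≠ q}, (i : Fin n) ≠ p → φ (mergedPoly p q i) = X i :=
    fun i hi => by rw [mergedPoly, if_neg hi, hφ]
  have hφp : φ (mergedPoly p q p) = X p * X q := by
    rw [mergedPoly, if_pos rfl, map_mul, hφ, hφ]
  have hmpure : ∀ (i : {i : Fin n // i ≠ q}) (h : H), Filter.Tendsto
      (fun N : ℕ => ‖(star (φ (mergedPoly p q i)) ^ N) h‖) Filter.atTop (nhds 0) := fun i h => by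
    by_cases hi : (i : Fin n) = p
    · refine squeeze_zero (fun _ => norm_nonneg _) (fun N => ?_) ((hpure p).2 h)
      rw [hi, hφp, star_mul, (hcomm q p).mul_pow, mul_apply_eq_comp]
      exact norm_pow_apply_le_of_norm_le_one (by rw [norm_star]; exact hXc.1 q) N _
    · rw [hφm i hi]
      exact (hpure i).2 h
  obtain ⟨J, hJ⟩ := exists_isometry_hardySpace φ (y := fun i : {i : Fin n // i ≠ q} =>
    mergedPoly p q i) (fun i => mergedPoly_mem p q i) hnorm hmpure W hW
  have hJX : ∀ i h k, (J (star (X i) h)).coeff k =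
      W (star (X i) (star (φ (∏ i : {i : Fin n // i ≠ q}, mergedPoly p q i ^ k i)) h)) :=
    fun i h k => by
      rw [hJ, ← mul_apply_eq_comp, ← mul_apply_eq_comp, ← hφ, ← star_mul, ← star_mul, ← map_mul,
        ← map_mul, mul_comm]
  have hJs : ∀ h (k : {i : Fin n // i ≠ q} → ℕ) (j : {i : Fin n // i ≠ q}),
      (J h).coeff (k + Pi.single j 1) =
      W (star (φ (mergedPoly p q j))
        (star (φ (∏ i : {i : Fin n // i ≠ q}, mergedPoly p q i ^ k i)) h)) := fun h k j => by
    have h1 : ∏ i : {i : Fin n // i ≠ q}, mergedPoly p q i ^ (k + Pi.single j 1 : _ → ℕ) i =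
        (∏ i : {i : Fin n // i ≠ q}, mergedPoly p q i ^ k i) * mergedPoly p q j := by
      simp only [Pi.add_apply, pow_add, Finset.prod_mul_distrib]
      congr 1
      rw [Finset.prod_eq_single j] <;> simp +contextual
    rw [hJ, h1, map_mul, star_mul, mul_apply_eq_comp]
  have hJp : ∀ h (k : {i : Fin n // i ≠ q} → ℕ), (J h).coeff (k + Pi.single ⟨p, hpq⟩ 1) =
      W (star (X p) (star (X q)
        (star (φ (∏ i : {i : Fin n // i ≠ q}, mergedPoly p q i ^ k i)) h))) := fun h k => by
    rw [hJs, hφp, ← (hXc.2 p q).eq.symm, star_mul, mul_apply_eq_comp]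
  refine ⟨J, fun i h => ?_⟩
  ext k
  rw [hJX]
  by_cases hiq : i = q
  · rw [hiq, coeff_star_dilationOp_right hpq _ _ hP, hJp, hJ, hB]
  · by_cases hip : i = p
    · rw [hip, coeff_star_dilationOp_left hpq _ _ hP, hJp, hJ, hA]
    · rw [coeff_star_dilationOp_of_ne hpq hip hiq, hJs, hφm ⟨i, hiq⟩ hip]

end Fin

end Model

end PolydiscDilation

open PolydiscDilation in
theorem mainTheorem11 {n : ℕ} {H : Type u} [NormedAddCommGroup H] [InnerProductSpace ℂ H]
    [CompleteSpace H] (p q : Fin n) (hpq : p ≠ q) (X : Fin n → H →L[ℂ] H)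
    (hX : PolydiscDilation.IsClassPQ p q X)
    (hpure : ∀ i, PolydiscDilation.IsPureContraction (X i))
    (hfin : PolydiscDilation.IsFiniteRank p q X) :
    ∃ (E : Type u) (_ : NormedAddCommGroup E) (_ : InnerProductSpace ℂ E) (_ : CompleteSpace E)
      (U P : E →L[ℂ] E)
      (V : Fin n → PolydiscDilation.HardySpace {i : Fin n // i ≠ q} E →L[ℂ]
        PolydiscDilation.HardySpace {i : Fin n // i ≠ q} E)
      (J : H →ₗᵢ[ℂ] PolydiscDilation.HardySpace {i : Fin n // i ≠ q} E),
      U ∈ unitary (E →L[ℂ] E) ∧ IsStarProjection P ∧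
      (∀ i, PolydiscDilation.IsMultiplicationOperator
        (PolydiscDilation.dilationSymbol hpq U P i) (V i)) ∧
      (∀ i j, Commute (V i) (V j)) ∧
      (∀ i, PolydiscDilation.IsPureIsometry (V i)) ∧
      (∀ i h, J (star (X i) h) = star (V i) (J h)) := by
  obtain ⟨hXc, hXp, hXq, -⟩ := hX
  obtain ⟨hfp, hfq⟩ := hfin
  have := FiniteDimensional.complete ℂ (defectSpace (removeEntry p X))
  have := FiniteDimensional.complete ℂ (defectSpace (removeEntry q X))
  obtain ⟨φ, hφ⟩ := exists_algHom_of_commute X hXc.2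
  have hsz : ∀ r, szegoInv (removeEntry r X) =
      hereditary φ (∏ i : {i : Fin n // i ≠ r}, (1 - MvPolynomial.X (i : Fin n))) := fun r => by
    rw [← szegoInv_eq_hereditary φ fun i => X_mem_monomialSubmonoid _]
    congr 1
    funext i
    exact (hφ i).symm
  have hdef : ∀ r, IsSzegoTuple (removeEntry r X) → ∀ h,
      ‖defectOp (removeEntry r X) h‖ ^ 2 = (⟪hereditary φ
        (∏ i : {i : Fin n // i ≠ r}, (1 - MvPolynomial.X (i : Fin n))) h, h⟫_ℂ).re :=
    fun r hr h => by rw [norm_sq_defectOp hr, hsz]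
  have hmul : ∀ r, IsSzegoTuple (removeEntry r X) → ∀ i h,
      ‖defectOp (removeEntry r X) (star (X i) h)‖ ^ 2 = (⟪hereditary φ (MvPolynomial.X i *
        ∏ i : {i : Fin n // i ≠ r}, (1 - MvPolynomial.X (i : Fin n))) h, h⟫_ℂ).re :=
    fun r hr i h => by
      rw [hdef r hr, re_inner_hereditary_mul φ (X_mem_monomialSubmonoid i), hφ]
  obtain ⟨hpoly1, hpoly2⟩ := prod_one_sub_mergedPoly hpq
  have hdefect1 : ∀ h, ‖defectOp (removeEntry p X) (star (X p) h)‖ ^ 2 +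
      ‖defectOp (removeEntry q X) h‖ ^ 2 =
      (⟪hereditary φ (∏ i : {i : Fin n // i ≠ q}, (1 - mergedPoly p q i)) h, h⟫_ℂ).re := fun h => by
    rw [hmul p hXp, hdef q hXq, hpoly1, map_add, add_apply, inner_add_left, Complex.add_re]
  have hdefect2 : ∀ h, ‖defectOp (removeEntry p X) h‖ ^ 2 +
      ‖defectOp (removeEntry q X) (star (X q) h)‖ ^ 2 =
      (⟪hereditary φ (∏ i : {i : Fin n // i ≠ q}, (1 - mergedPoly p q i)) h, h⟫_ℂ).re := fun h => by
    rw [hmul q hXq, hdef p hXp, hpoly2, map_add, add_apply, inner_add_left, Complex.add_re]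
  obtain ⟨U₀, P₀, W₀, hU₀, hP₀, hW₀, hA₀, hB₀⟩ := exists_model (defectOp (removeEntry p X))
    (defectOp (removeEntry q X)) (star (X p)) (star (X q)) (hXc.2 p q).star_star
    fun h => (hdefect2 h).trans (hdefect1 h).symm
  obtain ⟨E, U, P, W, hU, hP, hWn, hA, hB, hUP⟩ := exists_reduced_model hU₀ hP₀ (hpure p).2
    (hpure q).2 hA₀ hB₀
  obtain ⟨J, hJ⟩ := exists_intertwining_isometry hpq hXc hpure hφ hP W
    (fun h => by rw [hWn, hW₀, hdefect1]) hA hB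
  exact ⟨E, inferInstance, inferInstance, FiniteDimensional.complete ℂ E, U, P,
    dilationOp hpq U P, J, hU, hP, isMultiplicationOperator_dilationOp hpq U P,
    commute_dilationOp hpq hU hP, isPureIsometry_dilationOp hpq hU hP hUP, hJ⟩

end
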